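/- **Conventions.** Letters are drawn from a fixed infinite set; an alphabet is a non-empty finite set of letters; $V^*$ is the set of words over $V$ and $\lambda$ the empty word. Let $L$ be a regular language over an alphabet $V$. With respect to $V$, the language $L$ belongs to - $\mathit{REG}$ always; $\mathit{FIN}$ if $L$ is finite; $\mathit{MON}$ if $L=V^*$; $\mathit{NIL}$ if $L$ or $V^*\setminus L$ is finite; - $\mathit{COMB}$ if $L=V^*X$ for some $X\subseteq V$; $\mathit{DEF}$ if $L=A\cup V^*B$ for finite $A,B\subseteq V^*$; $\mathit{SYDEF}$ if $L=EV^*H$ for regular languages $E,H$ over $V$; - $\mathit{INF}$ (infix-closed) if $xyz\in L$ implies $y\in L$, $\mathit{PRE}$ (prefix-closed) if $xy\in L$ implies $x\in L$, $\mathit{SUF}$ (suffix-closed) if $xy\in L$ implies $y\in L$, for all $x,y,z\in V^*$; - $\mathit{ORD}$ if $L$ is accepted by a deterministic finite automaton with input alphabet $V$ whose state set carries a total order such that, for every letter $a\in V$, the map $z\mapsto\delta(z,a)$ is monotone; - $\mathit{COMM}$ if $L$ contains with each word all its permutations; $\mathit{CIRC}$ if $L$ contains with each word all its circular shifts; - $\mathit{NC}$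 if there is $k\ge1$ such that, for all $x,y,z\in V^*$, $xy^kz\in L\iff xy^{k+1}z\in L$; - $\mathit{PS}$ if there is $m\ge1$ such that, for every $x\in V^*$, the set $\{x^n : n\ge m\}$ is either disjoint from $L$ or contained in $L$; - $\mathit{UF}$ if $L$ is described by a regular expression built from $\emptyset$, $\lambda$ and letters by concatenation and Kleene closure only; $\mathit{STAR}$ if $L=H^*$ for a regular language $H$ over $V$; - $\mathit{LCOM}$, $\mathit{RCOM}$, $\mathit{2COM}$ if $L=EG^*$, $L=G^*H$, $L=EG^*H$, respectively, for regular languages $E,G,H$ over $V$ with $G\notin\{\emptyset,\{\lambda\}\}$. A contextual grammar with selection in a family $F$ is a triple $(V,\mathcal S,A)$ where $V$ is an alphabet, $A\subset V^*$ is a finite set of axioms, and $\mathcal S$ is a finite set of pairs $(S,C)$ such that $S$ belongs to $F$ with respect to some alphabet $U\subseteq V$ and $C\subset V^*\times V^*$ is finite with $uv\ne\lambda$ for all $(u,v)\in C$. A word $x$ externally derives $y$ in one step if $y=uxv$ for some $(S,C)\in\mathcal S$ with $x\in S$ and some $(u,v)\in C$. The externally generated language consists of all words derived from axioms in zero or more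 steps, and $\mathcal{EC}(F)$ is the family of all languages externally generated by contextual grammars with selection in $F$. **Theorem.** Consider the directed graph on the sixteen nodes $\mathit{FIN},\mathit{MON},\mathit{COMB},\mathit{NIL},\mathit{DEF},\mathit{ORD},\mathit{SYDEF},\mathit{INF},\mathit{SUF},\mathit{PRE},\mathit{COMM},\mathit{STAR},\mathit{NC},\mathit{PS},\mathit{CIRC},\mathit{REG}$ with the arrows $\mathit{FIN}\to\mathit{MON}$; $\mathit{MON}\to\mathit{NIL},\mathit{COMB},\mathit{INF},\mathit{STAR}$; $\mathit{COMB}\to\mathit{DEF}$; $\mathit{NIL}\to\mathit{DEF},\mathit{COMM}$; $\mathit{DEF}\to\mathit{ORD},\mathit{SYDEF}$; $\mathit{ORD}\to\mathit{NC}$; $\mathit{INF}\to\mathit{SUF},\mathit{PRE}$; $\mathit{NC},\mathit{SYDEF},\mathit{SUF},\mathit{PRE}\to\mathit{PS}$; $\mathit{COMM}\to\mathit{CIRC}$; $\mathit{STAR},\mathit{CIRC},\mathit{PS}\to\mathit{REG}$. 1. For every arrow $X\to Y$, the proper inclusion $\mathcal{EC}(X)\subset\mathcal{EC}(Y)$ holds.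 2. If there is no directed path (of length zero or more) from $X$ to $Y$ and none from $Y$ to $X$, then $\mathcal{EC}(X)$ and $\mathcal{EC}(Y)$ are incomparable, that is, neither is contained in the other. 3. $\mathcal{EC}(\mathit{REG})=\mathcal{EC}(\mathit{UF})=\mathcal{EC}(\mathit{LCOM})=\mathcal{EC}(\mathit{RCOM})=\mathcal{EC}(\mathit{2COM})$. -/

import Mathlib

namespace ContextualGrammars

universe u

/-- The set `U^*` of all words over the alphabet `U`. Letters are drawn from a type `α`; an alphabet
is a non-empty finite set of letters. -/
def wordsOver {α : Type u} (U : Finset α) : Language α :=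
  {w | ∀ a ∈ w, a ∈ U}

/-- The power `x^n` of a word. -/
def wordPow {α : Type u} (x : List α) (n : ℕ) : List α :=
  (List.replicate n x).flatten

/-- `L` is a regular language over the alphabet `U`. For a language contained in `U^*` it makes no
difference whether the finite automaton reads letters of `U` only or all letters of `α`: letters
outside `U` can be sent to a sink. -/
def RegularOver {α : Type u} (U : Finset α) (L : Language α) : Prop :=
  L.IsRegular ∧ L ≤ wordsOver U

/-- A family of languages: `F U L` says that `L` belongs to the family with respect to the
alphabet `U`. -/
abbrev Family (α : Type u) := Finset α → Language α → Prop

/-- All regular languages. -/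
def REG {α : Type u} : Family α := fun U L => RegularOver U L

/-- Finite languages. -/
def FIN {α : Type u} : Family α := fun U L =>
  RegularOver U L ∧ {w | w ∈ L}.Finite

/-- Monoidal languages. -/
def MON {α : Type u} : Family α := fun U L =>
  RegularOver U L ∧ L = wordsOver U

/-- Nilpotent languages. -/
def NIL {α : Type u} : Family α := fun U L =>
  RegularOver U L ∧ ({w | w ∈ L}.Finite ∨ {w | w ∈ wordsOver U ∧ w ∉ L}.Finite)

/-- The language of all one-letter words with a letter from `X`. -/
def letterWords {α : Type u} (X : Finset α) : Language α :=
  {w | ∃ a ∈ X, w = [a]}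

/-- Combinational languages. -/
def COMB {α : Type u} : Family α := fun U L =>
  RegularOver U L ∧ ∃ X : Finset α, X ⊆ U ∧ L = wordsOver U * letterWords X

/-- Definite languages; the sum of two languages is their union. -/
def DEF {α : Type u} : Family α := fun U L =>
  RegularOver U L ∧ ∃ A B : Language α, A ≤ wordsOver U ∧ B ≤ wordsOver U ∧
    {w | w ∈ A}.Finite ∧ {w | w ∈ B}.Finite ∧ L = A + wordsOver U * B

/-- Symmetric definite languages. -/
def SYDEF {α : Type u} : Family α := fun U L =>
  RegularOver U L ∧ ∃ E H : Language α, RegularOver U E ∧ RegularOver U H ∧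
    L = E * wordsOver U * H

/-- Infix-closed languages. -/
def INF {α : Type u} : Family α := fun U L =>
  RegularOver U L ∧ ∀ x ∈ wordsOver U, ∀ y ∈ wordsOver U, ∀ z ∈ wordsOver U,
    x ++ y ++ z ∈ L → y ∈ L

/-- Prefix-closed languages. -/
def PRE {α : Type u} : Family α := fun U L =>
  RegularOver U L ∧ ∀ x ∈ wordsOver U, ∀ y ∈ wordsOver U, x ++ y ∈ L → x ∈ L

/-- Suffix-closed languages. -/
def SUF {α : Type u} : Family α := fun U L =>
  RegularOver U L ∧ ∀ x ∈ wordsOver U, ∀ y ∈ wordsOver U, x ++ y ∈ L → y ∈ L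

/-- Ordered languages: accepted by a deterministic finite automaton with input alphabet `U` and a
totally ordered set of states such that every letter acts monotonically. -/
def ORD {α : Type u} : Family α := fun U L =>
  RegularOver U L ∧ ∃ (Z : Type) (_ : Fintype Z) (_ : LinearOrder Z) (M : DFA {a // a ∈ U} Z),
    (∀ a : {a // a ∈ U}, Monotone fun z => M.step z a) ∧
      ∀ w : List {a // a ∈ U}, w ∈ M.accepts ↔ w.map Subtype.val ∈ L

/-- Commutative languages. -/
def COMM {α : Type u} : Family α := fun U L =>
  RegularOver U L ∧ ∀ w ∈ L, ∀ w' : List α, w.Perm w' → w' ∈ L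

/-- Circular languages. -/
def CIRC {α : Type u} : Family α := fun U L =>
  RegularOver U L ∧ ∀ x y : List α, x ++ y ∈ L → y ++ x ∈ L

/-- Non-counting languages. -/
def NC {α : Type u} : Family α := fun U L =>
  RegularOver U L ∧ ∃ k : ℕ, 1 ≤ k ∧
    ∀ x ∈ wordsOver U, ∀ y ∈ wordsOver U, ∀ z ∈ wordsOver U,
      x ++ wordPow y k ++ z ∈ L ↔ x ++ wordPow y (k + 1) ++ z ∈ L

/-- Power-separating languages. -/
def PS {α : Type u} : Family α := fun U L =>
  RegularOver U L ∧ ∃ m : ℕ, 1 ≤ m ∧ ∀ x ∈ wordsOver U,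
    (∀ n, m ≤ n → wordPow x n ∉ L) ∨ (∀ n, m ≤ n → wordPow x n ∈ L)

/-- A regular expression is union-free if it is built from `∅`, the empty word and letters by
concatenation and Kleene closure only. -/
def IsUnionFree {α : Type u} : RegularExpression α → Prop
  | .zero => True
  | .epsilon => True
  | .char _ => True
  | .plus _ _ => False
  | .comp P Q => IsUnionFree P ∧ IsUnionFree Q
  | .star P => IsUnionFree P

/-- Union-free languages. -/
def UF {α : Type u} : Family α := fun U L =>
  RegularOver U L ∧ ∃ P : RegularExpression α, IsUnionFree P ∧ P.matches' = L

/-- Star languages. -/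
def STAR {α : Type u} : Family α := fun U L =>
  RegularOver U L ∧ ∃ H : Language α, RegularOver U H ∧ L = KStar.kstar H

/-- Left-sided comet languages; `0` is the empty language and `1` the language of the empty word. -/
def LCOM {α : Type u} : Family α := fun U L =>
  RegularOver U L ∧ ∃ E G : Language α, RegularOver U E ∧ RegularOver U G ∧ G ≠ 0 ∧ G ≠ 1 ∧
    L = E * KStar.kstar G

/-- Right-sided comet languages. -/
def RCOM {α : Type u} : Family α := fun U L =>
  RegularOver U L ∧ ∃ G H : Language α, RegularOver U G ∧ RegularOver U H ∧ G ≠ 0 ∧ G ≠ 1 ∧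
    L = KStar.kstar G * H

/-- Two-sided comet languages. -/
def TCOM {α : Type u} : Family α := fun U L =>
  RegularOver U L ∧ ∃ E G H : Language α, RegularOver U E ∧ RegularOver U G ∧ RegularOver U H ∧
    G ≠ 0 ∧ G ≠ 1 ∧ L = E * KStar.kstar G * H

/-- A contextual grammar with selection in `F`: an alphabet, a finite set of pairs `(S, C)` of a
selection language and a finite set of contexts, and a finite set of axioms. -/
structure Grammar {α : Type u} (F : Family α) where
  alphabet : Finset α
  alphabet_nonempty : alphabet.Nonempty
  selections : Set (Language α × Set (List α × List α))
  selections_finite : selections.Finite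
  selection_mem : ∀ p ∈ selections, ∃ U : Finset α, U.Nonempty ∧ U ⊆ alphabet ∧ F U p.1
  contexts_finite : ∀ p ∈ selections, p.2.Finite
  contexts_over : ∀ p ∈ selections, ∀ c ∈ p.2,
    c.1 ∈ wordsOver alphabet ∧ c.2 ∈ wordsOver alphabet
  contexts_ne : ∀ p ∈ selections, ∀ c ∈ p.2, c.1 ++ c.2 ≠ []
  axs : Set (List α)
  axs_finite : axs.Finite
  axs_over : ∀ w ∈ axs, w ∈ wordsOver alphabet

/-- A direct external derivation step. -/
def Grammar.Step {α : Type u} {F : Family α} (G : Grammar F) (x y : List α) : Prop :=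
  ∃ p ∈ G.selections, x ∈ p.1 ∧ ∃ c ∈ p.2, y = c.1 ++ x ++ c.2

/-- The language generated externally by a contextual grammar. -/
def Grammar.language {α : Type u} {F : Family α} (G : Grammar F) : Language α :=
  {z | ∃ x ∈ G.axs, Relation.ReflTransGen G.Step x z}

/-- The family of all languages generated externally by contextual grammars with selection
in `F`. -/
def EC {α : Type u} (F : Family α) : Set (Language α) :=
  {L | ∃ G : Grammar F, G.language = L}

/-- The nodes of the hierarchy diagram. -/
inductive Node
  | fin | mon | comb | nil | defn | ord | sydef | inf | suf | pre | comm | star | nc | ps | circ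
  | reg
  deriving DecidableEq

/-- The family of selection languages at a node. -/
def Node.family (α : Type u) : Node → Family α
  | .fin => FIN
  | .mon => MON
  | .comb => COMB
  | .nil => NIL
  | .defn => DEF
  | .ord => ORD
  | .sydef => SYDEF
  | .inf => INF
  | .suf => SUF
  | .pre => PRE
  | .comm => COMM
  | .star => STAR
  | .nc => NC
  | .ps => PS
  | .circ => CIRC
  | .reg => REG

/-- The arrows of the hierarchy diagram. -/
def arrows : List (Node × Node) :=
  [(.fin, .mon),
   (.mon, .nil), (.mon, .comb), (.mon, .inf), (.mon, .star),
   (.comb, .defn), (.nil, .defn), (.nil, .comm),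
   (.defn, .ord), (.defn, .sydef), (.ord, .nc), (.nc, .ps), (.sydef, .ps),
   (.inf, .suf), (.inf, .pre), (.suf, .ps), (.pre, .ps),
   (.comm, .circ),
   (.star, .reg), (.circ, .reg), (.ps, .reg)]

/-- There is an arrow from `X` to `Y` in the diagram. -/
def Arrow (X Y : Node) : Prop := (X, Y) ∈ arrows

/-- There is a directed path (possibly of length zero) from `X` to `Y` in the diagram. -/
def HasPath (X Y : Node) : Prop := Relation.ReflTransGen Arrow X Y

/-- Two families of languages are incomparable if neither is contained in the other. -/
def Incomparable {α : Type u} (A B : Set (Language α)) : Prop := ¬ A ⊆ B ∧ ¬ B ⊆ A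

end ContextualGrammars

/-!
The inclusions rest on `EC_subset_of_replace`: a selection language may be replaced by finitely many
languages that together agree with it on the words over the alphabet of the grammar, up to finitely
many words, because the finitely many words derived from the latter can be added to the axioms. Most
arrows of the diagram are even inclusions of the selection families. For the others, a finite
selection language is replaced by nothing, `U^*` by the set of all nonempty words over `U`
(`EC_MON_subset_COMB`), a cofinite language by the set of all long words
(`EC_NIL_subset`), and a definite one by finitely many languages `U^* b` (`EC_DEF_subset`), which
are symmetric definite and are accepted by the ordered automaton that remembers the last `|b|`
letters (`ord_wordsOver_mul_singleton`). Since a regular language is a finite union of union-free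
languages (`RegularOver.isUnionFreeSum`, from Arden's lemma and `(P + Q)∗ = (P∗ * Q∗)∗`), the
family `UF` is as powerful as `REG`; and so are the comet families, because a selection language `S`
may be replaced by `S a^*` or `a^* S` for a letter `a` foreign to the grammar
(`EC_REG_subset_of_padding`).

By monotonicity, all remaining claims follow from the 22 non-inclusions in `separations`. Some of
them are shown by grammars that have to distinguish between short and long words. For the rest, the
language `A^* ∪ c T c` with a marker `c` forces every selection language that contributes to `c T c`
to respect `T`: if it is generated with selection in `F`, then up to finitely many words `T` is a
finite union of languages `u (S ∩ A^*) v` with `S` in `F` (`FinitelyCovered`). So it suffices to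
find a language `T` of one family without such a covering by another family, and by
`FinitelyCovered.exists_middle` the middle part of a long word of `T` can be manipulated within a
single language of the covering.

The exception is a non-counting language that is not covered by ordered languages, for which a
single word does not suffice. The language `rotationWords` describes runs through three states in
cyclic order in which the `j`-th letter is forbidden in the state `j`. A piece of a covering that
survives along as many words as possible must distinguish the three states, and then three monotone
maps would rotate three disjoint classes of a finite chain. This is impossible
(`not_exists_monotone_rotation`): alternating chains of maximal length rotate along with the
classes, and their greatest elements would be ordered cyclically.
-/

namespace ContextualGrammars

universe u

variable {α : Type u}

open Computability

/-! ### Closure properties of regular languages -/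

/-- A language is regular if membership of `w ++ y` depends on `w` only through a value in a finite
type. -/
theorem isRegular_of_finite_invariant {σ : Type*} [Finite σ] {L : Language α} (f : List α → σ)
    (hf : ∀ w w' : List α, f w = f w' → ∀ y, w ++ y ∈ L → w' ++ y ∈ L) : L.IsRegular := by
  apply Language.IsRegular.of_finite_range_leftQuotient
  refine Set.Finite.of_finite_image (f := fun Q => {s | ∃ w, f w = s ∧ L.leftQuotient w = Q})
    (Set.toFinite _) ?_
  rintro _ ⟨w, rfl⟩ _ ⟨w', rfl⟩ h
  have : f w ∈ {s | ∃ v, f v = s ∧ L.leftQuotient v = L.leftQuotient w'} := by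
    have h' : f w ∈ {s | ∃ v, f v = s ∧ L.leftQuotient v = L.leftQuotient w} := ⟨w, rfl, rfl⟩
    exact (Set.ext_iff.1 h (f w)).1 h'
  obtain ⟨v, hv, hvw⟩ := this
  rw [← hvw]
  exact Language.ext fun y => ⟨hf w v hv.symm y, hf v w hv y⟩

/-- By the Myhill–Nerode theorem: the left quotient of `L * M` by `w` is determined by the left
quotient of `L` by `w` and the set of left quotients of `M` by those suffixes of `w` whose
complementary prefix lies in `L`. -/
theorem isRegular_mul {L M : Language α} (hL : L.IsRegular) (hM : M.IsRegular) :
    (L * M).IsRegular := by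
  apply Language.IsRegular.of_finite_range_leftQuotient
  have h1 := hL.finite_range_leftQuotient
  have h2 := hM.finite_range_leftQuotient
  refine ((h1.prod h2.finite_subsets).image
    fun p : Language α × Set (Language α) => p.1 * M + sSup p.2).subset ?_
  rintro _ ⟨w, rfl⟩
  refine ⟨(L.leftQuotient w, {Q | ∃ u ∈ L, ∃ v, w = u ++ v ∧ Q = M.leftQuotient v}),
    ⟨⟨w, rfl⟩, ?_⟩, ?_⟩
  · rintro _ ⟨u, -, v, -, rfl⟩
    exact ⟨v, rfl⟩
  · ext y
    simp only [Language.mem_add, Language.mem_leftQuotient, Language.mem_mul]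
    constructor
    · rintro (⟨p, hp, q, hq, rfl⟩ | ⟨_, ⟨u, hu, v, rfl, rfl⟩, hy⟩)
      · exact ⟨w ++ p, hp, q, hq, by simp⟩
      · exact ⟨u, hu, v ++ y, hy, by simp⟩
    · rintro ⟨p, hp, q, hq, h⟩
      rcases List.append_eq_append_iff.1 h with ⟨v, rfl, rfl⟩ | ⟨v, rfl, rfl⟩
      · exact Or.inr ⟨_, ⟨p, hp, v, rfl, rfl⟩, hq⟩
      · exact Or.inl ⟨v, hp, q, hq, rfl⟩

/-- By the Myhill–Nerode theorem: for `w ≠ []` the left quotient of `L∗` by `w` is determined by the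
set of left quotients of `L` by those suffixes of `w` whose complementary prefix lies in `L∗`. -/
theorem isRegular_kstar {L : Language α} (hL : L.IsRegular) : (L∗).IsRegular := by
  apply Language.IsRegular.of_finite_range_leftQuotient
  have h1 := hL.finite_range_leftQuotient
  refine ((h1.finite_subsets.image
    fun Q : Set (Language α) => sSup Q * L∗).insert L∗).subset ?_
  rintro _ ⟨w, rfl⟩
  rcases eq_or_ne w [] with rfl | hw
  · exact Or.inl rfl
  refine Or.inr ⟨{Q | ∃ u ∈ L∗, ∃ v, w = u ++ v ∧ Q = L.leftQuotient v}, ?_, ?_⟩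
  · rintro _ ⟨u, -, v, -, rfl⟩
    exact ⟨v, rfl⟩
  · ext y
    simp only [Language.mem_leftQuotient, Language.mem_mul]
    constructor
    · rintro ⟨p, ⟨_, ⟨u, ⟨l, rfl, hl⟩, v, rfl, rfl⟩, hp⟩, q, ⟨l', rfl, hl'⟩, rfl⟩
      refine ⟨l ++ [v ++ p] ++ l', by simp, ?_⟩
      intro z hz
      simp only [List.mem_append, List.mem_singleton] at hz
      rcases hz with (hz | rfl) | hz
      exacts [hl z hz, hp, hl' z hz]
    · rintro ⟨l, hl, hl'⟩
      -- split at the factor of the decomposition that contains the last letter of `w`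
      induction l generalizing w with
      | nil => simp at hl; exact absurd hl.1 hw
      | cons z l ih =>
        rw [List.flatten_cons] at hl
        have hz : z ∈ L := hl' z (by simp)
        rcases List.append_eq_append_iff.1 hl with ⟨v, rfl, rfl⟩ | ⟨v, rfl, hv⟩
        · exact ⟨v, ⟨_, ⟨[], Language.nil_mem_kstar _, w, rfl, rfl⟩, hz⟩, _,
            ⟨l, rfl, fun q hq => hl' q (by simp [hq])⟩, rfl⟩
        · rcases eq_or_ne v [] with rfl | hne
          · refine ⟨[], ⟨_, ⟨[], Language.nil_mem_kstar _, z, by simp, rfl⟩, ?_⟩, y,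
              ⟨l, by simpa using hv.symm, fun q hq => hl' q (by simp [hq])⟩, rfl⟩
            change z ++ [] ∈ L
            simpa using hz
          · obtain ⟨p, ⟨_, ⟨u, ⟨l₁, rfl, hl₁⟩, v', rfl, rfl⟩, hp⟩, q, hq, rfl⟩ :=
              ih v hne hv.symm (fun q hq => hl' q (by simp [hq]))
            refine ⟨p, ⟨_, ⟨z ++ l₁.flatten, ⟨z :: l₁, by simp, ?_⟩, v', by simp, rfl⟩, hp⟩,
              q, hq, rfl⟩
            intro q hq
            rcases List.mem_cons.1 hq with rfl | hq
            exacts [hz, hl₁ q hq]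

theorem isRegular_zero : (0 : Language α).IsRegular :=
  isRegular_of_finite_invariant (fun _ => ()) fun _ _ _ _ h => h.elim

theorem isRegular_one : (1 : Language α).IsRegular :=
  isRegular_of_finite_invariant (fun w => w = []) fun w w' h y hy => by
    simp_all

theorem isRegular_letter (a : α) : ({[a]} : Language α).IsRegular := by
  refine isRegular_of_finite_invariant (fun w => (w = [], w = [a])) fun w w' h y hy => ?_
  simp only [Prod.mk.injEq, eq_iff_iff] at h
  change w ++ y = [a] at hy
  change w' ++ y = [a]
  rcases List.append_eq_singleton_iff.1 hy with ⟨h1, rfl⟩ | ⟨h1, rfl⟩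
  · simp [h.1.1 h1]
  · simp [h.2.1 h1]

theorem isRegular_singleton (w : List α) : ({w} : Language α).IsRegular := by
  induction w with
  | nil => exact isRegular_one
  | cons a w ih =>
    have : ({a :: w} : Language α) = {[a]} * {w} := by
      ext x
      constructor
      · rintro rfl
        exact ⟨[a], rfl, w, rfl, rfl⟩
      · rintro ⟨_, rfl, _, rfl, rfl⟩
        rfl
    rw [this]
    exact isRegular_mul (isRegular_letter a) ih

theorem isRegular_of_finite {L : Language α} (h : {w | w ∈ L}.Finite) : L.IsRegular := by
  have key : ∀ S : Set (List α), S.Finite → Language.IsRegular (T := α) S := by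
    intro S hS
    induction S, hS using Set.Finite.induction_on with
    | empty => exact isRegular_zero
    | @insert w S _ _ ih => exact (isRegular_singleton w).add ih
  exact key _ h

theorem isRegular_wordsOver (U : Finset α) : (wordsOver U).IsRegular := by
  refine isRegular_of_finite_invariant (fun w => ∀ a ∈ w, a ∈ U) fun w w' h y hy => ?_
  simp only [eq_iff_iff] at h
  have hy' : ∀ a ∈ w ++ y, a ∈ U := hy
  intro a ha
  rcases List.mem_append.1 ha with ha | ha
  · exact h.1 (fun b hb => hy' b (by simp [hb])) a ha
  · exact hy' a (by simp [ha])

/-! ### Words over an alphabet -/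

theorem mem_wordsOver {U : Finset α} {w : List α} : w ∈ wordsOver U ↔ ∀ a ∈ w, a ∈ U := Iff.rfl

@[simp]
theorem nil_mem_wordsOver (U : Finset α) : [] ∈ wordsOver U := by simp [mem_wordsOver]

@[simp]
theorem cons_mem_wordsOver {U : Finset α} {a : α} {w : List α} :
    a :: w ∈ wordsOver U ↔ a ∈ U ∧ w ∈ wordsOver U := by simp [mem_wordsOver]

@[simp]
theorem append_mem_wordsOver {U : Finset α} {v w : List α} :
    v ++ w ∈ wordsOver U ↔ v ∈ wordsOver U ∧ w ∈ wordsOver U := by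
  simp only [mem_wordsOver, List.mem_append]
  exact ⟨fun h => ⟨fun a ha => h a (Or.inl ha), fun a ha => h a (Or.inr ha)⟩,
    fun h a ha => ha.elim (h.1 a) (h.2 a)⟩

theorem wordsOver_mono {U V : Finset α} (h : U ⊆ V) : wordsOver U ≤ wordsOver V :=
  fun _ hw a ha => h (hw a ha)

theorem replicate_mem_wordsOver {U : Finset α} {a : α} (ha : a ∈ U) (n : ℕ) :
    List.replicate n a ∈ wordsOver U := fun _ hb => (List.eq_of_mem_replicate hb) ▸ ha

theorem finite_wordsOver_length_lt (U : Finset α) (n : ℕ) :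
    {w | w ∈ wordsOver U ∧ w.length < n}.Finite := by
  refine ((List.finite_length_lt U n).image (List.map Subtype.val)).subset ?_
  rintro w ⟨hw, hn⟩
  replace hw : ∀ a ∈ w, a ∈ U := hw
  exact ⟨w.attachWith (· ∈ U) hw, by simpa using hn, by simp⟩

theorem wordPow_zero (x : List α) : wordPow x 0 = [] := rfl

theorem wordPow_succ (x : List α) (n : ℕ) : wordPow x (n + 1) = x ++ wordPow x n := by
  simp [wordPow, List.replicate_succ]

theorem wordPow_add (x : List α) (m n : ℕ) : wordPow x (m + n) = wordPow x m ++ wordPow x n := by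
  rw [wordPow, ← List.replicate_append_replicate, List.flatten_append]; rfl

theorem wordPow_succ' (x : List α) (n : ℕ) : wordPow x (n + 1) = wordPow x n ++ x := by
  rw [wordPow_add]; simp [wordPow]

@[simp]
theorem length_wordPow (x : List α) (n : ℕ) : (wordPow x n).length = n * x.length := by
  simp [wordPow]

theorem wordPow_singleton (a : α) (n : ℕ) : wordPow [a] n = List.replicate n a := by
  induction n with
  | zero => rfl
  | succ n ih => simp [wordPow_succ, ih, List.replicate_succ]

theorem wordPow_mem_wordsOver {U : Finset α} {x : List α} (hx : x ∈ wordsOver U) (n : ℕ) :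
    wordPow x n ∈ wordsOver U := by
  induction n with
  | zero => simp [wordPow_zero]
  | succ n ih => simp [wordPow_succ, hx, ih]

theorem regularOver_wordsOver (U : Finset α) : RegularOver U (wordsOver U) :=
  ⟨isRegular_wordsOver U, le_rfl⟩

theorem mul_le_wordsOver {U : Finset α} {L M : Language α} (hL : L ≤ wordsOver U)
    (hM : M ≤ wordsOver U) : L * M ≤ wordsOver U := by
  rintro _ ⟨x, hx, y, hy, rfl⟩
  exact append_mem_wordsOver.2 ⟨hL hx, hM hy⟩

theorem kstar_le_wordsOver {U : Finset α} {L : Language α} (hL : L ≤ wordsOver U) :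
    L∗ ≤ wordsOver U := by
  rintro _ ⟨l, rfl, hl⟩ a ha
  obtain ⟨w, hw, ha⟩ := List.mem_flatten.1 ha
  exact hL (hl w hw) a ha

theorem RegularOver.mem_wordsOver {U : Finset α} {L : Language α} (hL : RegularOver U L)
    {w : List α} (hw : w ∈ L) : w ∈ wordsOver U :=
  hL.2 hw

theorem RegularOver.mul {U : Finset α} {L M : Language α} (hL : RegularOver U L)
    (hM : RegularOver U M) : RegularOver U (L * M) :=
  ⟨isRegular_mul hL.1 hM.1, mul_le_wordsOver hL.2 hM.2⟩

theorem RegularOver.kstar {U : Finset α} {L : Language α} (hL : RegularOver U L) :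
    RegularOver U L∗ :=
  ⟨isRegular_kstar hL.1, kstar_le_wordsOver hL.2⟩

theorem RegularOver.add {U : Finset α} {L M : Language α} (hL : RegularOver U L)
    (hM : RegularOver U M) : RegularOver U (L + M) :=
  ⟨hL.1.add hM.1, sup_le hL.2 hM.2⟩

theorem regularOver_one (U : Finset α) : RegularOver U (1 : Language α) :=
  ⟨isRegular_one, by rintro _ rfl; exact nil_mem_wordsOver U⟩

theorem regularOver_of_finite {U : Finset α} {L : Language α} (h : {w | w ∈ L}.Finite)
    (hL : L ≤ wordsOver U) : RegularOver U L :=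
  ⟨isRegular_of_finite h, hL⟩

theorem regularOver_singleton {U : Finset α} {w : List α} (hw : w ∈ wordsOver U) :
    RegularOver U ({w} : Language α) :=
  ⟨isRegular_singleton w, by rintro _ rfl; exact hw⟩

theorem regularOver_mono {U V : Finset α} (h : U ⊆ V) {L : Language α} (hL : RegularOver U L) :
    RegularOver V L :=
  ⟨hL.1, hL.2.trans (wordsOver_mono h)⟩

theorem mem_kstar_singleton {x w : List α} :
    w ∈ ({x} : Language α)∗ ↔ ∃ n, w = wordPow x n := by
  constructor
  · rintro ⟨l, rfl, hl⟩
    exact ⟨l.length, by rw [List.eq_replicate_of_mem (a := x) hl, wordPow]; simp⟩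
  · rintro ⟨n, rfl⟩
    exact ⟨List.replicate n x, rfl, fun y hy => List.eq_of_mem_replicate hy⟩

/-! ### Regular languages are finite unions of union-free languages -/

theorem isRegular_matches' (P : RegularExpression α) : P.matches'.IsRegular := by
  induction P with
  | zero => exact isRegular_zero
  | epsilon => exact isRegular_one
  | char a => exact isRegular_letter a
  | plus P Q hP hQ => exact hP.add hQ
  | comp P Q hP hQ => exact isRegular_mul hP hQ
  | star P hP => exact isRegular_kstar hP

/-- A language that is a finite union of languages of union-free regular expressions. -/
def IsUnionFreeSum (L : Language α) : Prop :=
  ∃ l : List (RegularExpression α), (∀ P ∈ l, IsUnionFree P) ∧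
    L = (l.map RegularExpression.matches').sum

theorem IsUnionFreeSum.of_isUnionFree {P : RegularExpression α} (hP : IsUnionFree P) :
    IsUnionFreeSum P.matches' :=
  ⟨[P], by simpa using hP, by simp⟩

theorem isUnionFreeSum_zero : IsUnionFreeSum (0 : Language α) := ⟨[], by simp, by simp⟩

theorem isUnionFreeSum_one : IsUnionFreeSum (1 : Language α) :=
  .of_isUnionFree (P := .epsilon) trivial

theorem isUnionFreeSum_letter (a : α) : IsUnionFreeSum ({[a]} : Language α) :=
  .of_isUnionFree (P := .char a) trivial

theorem IsUnionFreeSum.add {L M : Language α} (hL : IsUnionFreeSum L) (hM : IsUnionFreeSum M) :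
    IsUnionFreeSum (L + M) := by
  obtain ⟨l, hl, rfl⟩ := hL
  obtain ⟨m, hm, rfl⟩ := hM
  refine ⟨l ++ m, fun P hP => ?_, by simp⟩
  exact (List.mem_append.1 hP).elim (hl P) (hm P)

theorem IsUnionFreeSum.sum {ι : Type*} (s : Finset ι) {f : ι → Language α}
    (h : ∀ i ∈ s, IsUnionFreeSum (f i)) : IsUnionFreeSum (∑ i ∈ s, f i) :=
  Finset.sum_induction f IsUnionFreeSum (fun _ _ => .add) isUnionFreeSum_zero h

theorem IsUnionFreeSum.mul {L M : Language α} (hL : IsUnionFreeSum L) (hM : IsUnionFreeSum M) :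
    IsUnionFreeSum (L * M) := by
  obtain ⟨l, hl, rfl⟩ := hL
  induction l with
  | nil => simpa using isUnionFreeSum_zero
  | cons P l ih =>
    rw [List.map_cons, List.sum_cons, add_mul]
    refine IsUnionFreeSum.add ?_ (ih fun Q hQ => hl Q (by simp [hQ]))
    obtain ⟨m, hm, rfl⟩ := hM
    refine ⟨m.map (P.comp ·), ?_, ?_⟩
    · intro R hR
      obtain ⟨Q, hQ, rfl⟩ := List.mem_map.1 hR
      exact ⟨hl P (by simp), hm Q hQ⟩
    · rw [← List.sum_map_mul_left, List.map_map]
      rfl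

theorem kstar_add_eq (a b : Language α) : (a + b)∗ = (a∗ * b∗)∗ := by
  apply le_antisymm
  · refine kstar_mono (add_le ?_ ?_)
    · exact (le_kstar.trans (le_of_eq (mul_one _).symm)).trans (mul_le_mul' le_rfl one_le_kstar)
    · exact (le_kstar.trans (le_of_eq (one_mul _).symm)).trans (mul_le_mul' one_le_kstar le_rfl)
  · have ha : a∗ ≤ (a + b)∗ := kstar_mono (le_add_of_nonneg_right bot_le)
    have hb : b∗ ≤ (a + b)∗ := kstar_mono (le_add_of_nonneg_left bot_le)
    have : a∗ * b∗ ≤ (a + b)∗ := (mul_le_mul' ha hb).trans (by simp)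
    exact (kstar_mono this).trans (by simp)

/-- The star of a union is union-free, as `(P + Q)∗ = (P∗ * Q∗)∗`. -/
theorem IsUnionFreeSum.kstar {L : Language α} (hL : IsUnionFreeSum L) : IsUnionFreeSum L∗ := by
  obtain ⟨l, hl, rfl⟩ := hL
  suffices ∃ P : RegularExpression α, IsUnionFree P ∧
      P.matches' = (l.map RegularExpression.matches').sum∗ by
    obtain ⟨P, hP, h⟩ := this
    exact h ▸ .of_isUnionFree hP
  induction l with
  | nil => exact ⟨.epsilon, trivial, by simp⟩
  | cons P l ih =>
    obtain ⟨Q, hQ, h⟩ := ih fun Q hQ => hl Q (by simp [hQ])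
    refine ⟨.star (.comp (.star P) Q), ⟨hl P (by simp), hQ⟩, ?_⟩
    rw [List.map_cons, List.sum_cons, kstar_add_eq, ← h]
    rfl

/-- Gaussian elimination by Arden's lemma: the solution of a right-linear system of equations whose
coefficients do not contain the empty word is built from the coefficients. -/
theorem isUnionFreeSum_of_linear_system (n : ℕ) (A : Fin n → Fin n → Language α)
    (B X : Fin n → Language α) (hA : ∀ i j, IsUnionFreeSum (A i j)) (hA' : ∀ i j, [] ∉ A i j)
    (hB : ∀ i, IsUnionFreeSum (B i)) (hX : ∀ i, X i = ∑ j, A i j * X j + B i) (i : Fin n) :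
    IsUnionFreeSum (X i) := by
  induction n with
  | zero => exact i.elim0
  | succ n ih =>
    set l := Fin.last n
    have hl : X l = (A l l)∗ * (∑ j : Fin n, A l j.castSucc * X j.castSucc + B l) := by
      rw [← Language.self_eq_mul_add_iff (hA' l l)]
      conv_lhs => rw [hX l, Fin.sum_univ_castSucc]
      abel
    have hsucc : ∀ i : Fin n, IsUnionFreeSum (X i.castSucc) := by
      refine ih (fun i j => A i.castSucc j.castSucc + A i.castSucc l * (A l l)∗ * A l j.castSucc)
        (fun i => B i.castSucc + A i.castSucc l * (A l l)∗ * B l) (fun i => X i.castSucc)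
        (fun i j => (hA _ _).add (((hA _ _).mul (hA _ _).kstar).mul (hA _ _))) ?_
        (fun i => (hB _).add (((hA _ _).mul (hA _ _).kstar).mul (hB _))) ?_
      · rintro i j (h | ⟨x, -, y, hy, h⟩)
        · exact hA' _ _ h
        · obtain ⟨rfl, rfl⟩ := List.append_eq_nil_iff.1 h
          exact hA' _ _ hy
      · intro i
        conv_lhs => rw [hX i.castSucc, Fin.sum_univ_castSucc]
        change _ + A i.castSucc l * X l + _ = _
        rw [hl]
        simp only [add_mul, mul_add, Finset.mul_sum, Finset.sum_add_distrib, mul_assoc]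
        abel
    refine Fin.lastCases ?_ hsucc i
    rw [hl]
    exact (hA _ _).kstar.mul ((IsUnionFreeSum.sum _ fun j _ => (hA _ _).mul (hsucc j)).add (hB _))

theorem mem_finset_sum {ι : Type*} {s : Finset ι} {f : ι → Language α} {w : List α} :
    w ∈ ∑ i ∈ s, f i ↔ ∃ i ∈ s, w ∈ f i := by
  classical
  induction s using Finset.induction_on with
  | empty => simp
  | insert i s hi ih =>
    rw [Finset.sum_insert hi, Language.mem_add, ih]
    simp

/-- The languages accepted from the various states of an automaton solve a right-linear system whose
coefficients are sets of letters. -/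
theorem RegularOver.isUnionFreeSum {U : Finset α} {L : Language α} (hL : RegularOver U L) :
    IsUnionFreeSum L := by
  classical
  obtain ⟨⟨σ, _, M, rfl⟩, hU⟩ := hL
  let e := Fintype.equivFin σ
  let X : Fin (Fintype.card σ) → Language α := fun i => M.acceptsFrom (e.symm i) ⊓ wordsOver U
  have hX : M.accepts = X (e M.start) := by
    simp only [X, Equiv.symm_apply_apply]
    exact (inf_eq_left.2 hU).symm
  rw [hX]
  refine isUnionFreeSum_of_linear_system _
    (fun i j => ∑ a ∈ U with M.step (e.symm i) a = e.symm j, {[a]})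
    (fun i => if e.symm i ∈ M.accept then 1 else 0) X
    (fun i j => .sum _ fun a _ => isUnionFreeSum_letter a) ?_ ?_ ?_ _
  · intro i j h
    obtain ⟨a, -, h⟩ := mem_finset_sum.1 h
    exact absurd h (List.cons_ne_nil _ _).symm
  · intro i
    split_ifs
    exacts [isUnionFreeSum_one, isUnionFreeSum_zero]
  · intro i
    ext w
    simp only [Language.mem_add, mem_finset_sum, Finset.mem_univ, true_and, X, Language.mem_inf,
      DFA.mem_acceptsFrom, Language.mem_mul, Finset.mem_filter]
    constructor
    · rintro ⟨h1, h2⟩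
      cases w with
      | nil =>
        right
        rw [DFA.evalFrom_nil] at h1
        rw [if_pos h1]
        rfl
      | cons a w =>
        rw [cons_mem_wordsOver] at h2
        exact Or.inl ⟨e (M.step (e.symm i) a), [a], ⟨a, ⟨h2.1, by simp⟩, rfl⟩, w,
          ⟨by simpa using h1, h2.2⟩, rfl⟩
    · rintro (⟨j, _, ⟨a, ⟨ha, hj⟩, rfl⟩, w, ⟨h1, h2⟩, rfl⟩ | h)
      · refine ⟨?_, cons_mem_wordsOver.2 ⟨ha, h2⟩⟩
        change M.evalFrom (e.symm i) (a :: w) ∈ _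
        rwa [DFA.evalFrom_cons, hj]
      · split_ifs at h with hi
        · obtain rfl : w = [] := h
          exact ⟨hi, nil_mem_wordsOver U⟩
        · exact h.elim

/-! ### Languages generated by contextual grammars -/

theorem Grammar.mem_language_of_mem_axs {F : Family α} (G : Grammar F) {w : List α}
    (hw : w ∈ G.axs) : w ∈ G.language :=
  ⟨w, hw, .refl⟩

theorem Grammar.mem_language_of_step {F : Family α} (G : Grammar F)
    {p : Language α × Set (List α × List α)} (hp : p ∈ G.selections) {x : List α} (hx : x ∈ p.1)
    (hxL : x ∈ G.language) {c : List α × List α} (hc : c ∈ p.2) :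
    c.1 ++ x ++ c.2 ∈ G.language := by
  obtain ⟨w, hw, h⟩ := hxL
  exact ⟨w, hw, h.tail ⟨p, hp, hx, c, hc, rfl⟩⟩

theorem Grammar.mem_axs_or_exists_step {F : Family α} (G : Grammar F) {w : List α}
    (hw : w ∈ G.language) :
    w ∈ G.axs ∨ ∃ p ∈ G.selections, ∃ x ∈ p.1, x ∈ G.language ∧ ∃ c ∈ p.2,
      w = c.1 ++ x ++ c.2 := by
  obtain ⟨z, hz, h⟩ := hw
  rcases h.cases_tail with rfl | ⟨x, hzx, p, hp, hx, c, hc, rfl⟩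
  · exact Or.inl hz
  · exact Or.inr ⟨p, hp, x, hx, ⟨z, hz, hzx⟩, c, hc, rfl⟩

theorem Grammar.language_le {F : Family α} (G : Grammar F) :
    G.language ≤ wordsOver G.alphabet := by
  rintro w ⟨z, hz, h⟩
  induction h with
  | refl => exact G.axs_over z hz
  | tail _ h ih =>
    obtain ⟨p, hp, -, c, hc, rfl⟩ := h
    have := G.contexts_over p hp c hc
    exact append_mem_wordsOver.2 ⟨append_mem_wordsOver.2 ⟨this.1, ih⟩, this.2⟩

/-- A language is generated by a grammar if it contains the axioms, is closed under derivation
steps, and each of its words is an axiom or arises by a derivation step from a word of it. -/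
theorem mem_EC_of_closed {F : Family α} {L : Language α} (V : Finset α) (hV : V.Nonempty)
    (hL : L ≤ wordsOver V) (sel : Set (Language α × Set (List α × List α))) (hsel : sel.Finite)
    (hF : ∀ p ∈ sel, ∃ U : Finset α, U.Nonempty ∧ U ⊆ V ∧ F U p.1)
    (hfin : ∀ p ∈ sel, p.2.Finite)
    (hover : ∀ p ∈ sel, ∀ c ∈ p.2, c.1 ∈ wordsOver V ∧ c.2 ∈ wordsOver V)
    (hne : ∀ p ∈ sel, ∀ c ∈ p.2, c.1 ++ c.2 ≠ [])
    (ax : Set (List α)) (hax : ax.Finite) (haxL : ∀ w ∈ ax, w ∈ L)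
    (hclosed : ∀ p ∈ sel, ∀ x ∈ p.1, x ∈ L → ∀ c ∈ p.2, c.1 ++ x ++ c.2 ∈ L)
    (hgen : ∀ w ∈ L, w ∈ ax ∨ ∃ p ∈ sel, ∃ x ∈ p.1, x ∈ L ∧ ∃ c ∈ p.2, w = c.1 ++ x ++ c.2) :
    L ∈ EC F := by
  let G : Grammar F :=
    { alphabet := V, alphabet_nonempty := hV, selections := sel, selections_finite := hsel,
      selection_mem := hF, contexts_finite := hfin, contexts_over := hover, contexts_ne := hne,
      axs := ax, axs_finite := hax, axs_over := fun w hw => hL (haxL w hw) }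
  refine ⟨G, Language.ext fun w => ⟨?_, fun hw => ?_⟩⟩
  · rintro ⟨z, hz, h⟩
    induction h with
    | refl => exact haxL z hz
    | tail _ h ih =>
      obtain ⟨p, hp, hx, c, hc, rfl⟩ := h
      exact hclosed p hp _ hx ih c hc
  · induction hn : w.length using Nat.strong_induction_on generalizing w with
    | _ n ih =>
      subst hn
      rcases hgen w hw with h | ⟨p, hp, x, hx, hxL, c, hc, rfl⟩
      · exact G.mem_language_of_mem_axs h
      · refine G.mem_language_of_step hp hx (ih _ ?_ x hxL rfl) hc
        have := List.length_pos_iff.2 (hne p hp c hc)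
        simp only [List.length_append] at this ⊢
        omega

/-- Replacing selection languages. Each selection language `S` may be replaced by finitely many
languages that together agree with `S` on the words over the alphabet of the grammar, up to
finitely many words: the words derived from the latter become axioms. The alphabet may grow in the
process. -/
theorem EC_subset_of_replace {F F' : Family α}
    (h : ∀ V : Finset α, ∃ V' : Finset α, V ⊆ V' ∧ ∀ U ⊆ V, U.Nonempty → ∀ S, F U S →
      ∃ 𝒮 : Set (Language α), 𝒮.Finite ∧ (∀ S' ∈ 𝒮, ∃ U', U'.Nonempty ∧ U' ⊆ V' ∧ F' U' S') ∧
        {w | w ∈ S ∧ ∀ S' ∈ 𝒮, w ∉ S'}.Finite ∧ ∀ S' ∈ 𝒮, ∀ w ∈ S', w ∈ wordsOver V → w ∈ S) :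
    EC F ⊆ EC F' := by
  rintro _ ⟨G, rfl⟩
  obtain ⟨V', hVV', h⟩ := h G.alphabet
  have h' : ∀ p ∈ G.selections, ∃ 𝒮 : Set (Language α), 𝒮.Finite ∧
      (∀ S' ∈ 𝒮, ∃ U', U'.Nonempty ∧ U' ⊆ V' ∧ F' U' S') ∧
      {w | w ∈ p.1 ∧ ∀ S' ∈ 𝒮, w ∉ S'}.Finite ∧
      ∀ S' ∈ 𝒮, ∀ w ∈ S', w ∈ wordsOver G.alphabet → w ∈ p.1 := by
    intro p hp
    obtain ⟨U, hU, hUV, hF⟩ := G.selection_mem p hp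
    exact h U hUV hU p.1 hF
  choose! 𝒮 hfin hF' hdiff hsub using h'
  have hle := G.language_le
  refine mem_EC_of_closed V' (G.alphabet_nonempty.mono hVV') (hle.trans (wordsOver_mono hVV'))
    (⋃ p ∈ G.selections, (fun S' => (S', p.2)) '' 𝒮 p)
    (G.selections_finite.biUnion fun p hp => (hfin p hp).image _) ?_ ?_ ?_ ?_
    (G.axs ∪ {w | w ∈ G.language ∧ ∃ p ∈ G.selections, ∃ x ∈ {w | w ∈ p.1 ∧ ∀ S' ∈ 𝒮 p, w ∉ S'},
      ∃ c ∈ p.2, w = c.1 ++ x ++ c.2}) ?_ ?_ ?_ ?_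
  · intro q hq
    simp only [Set.mem_iUnion] at hq
    obtain ⟨p, hp, S', hS', rfl⟩ := hq
    exact hF' p hp S' hS'
  · intro q hq
    simp only [Set.mem_iUnion] at hq
    obtain ⟨p, hp, S', hS', rfl⟩ := hq
    exact G.contexts_finite p hp
  · intro q hq
    simp only [Set.mem_iUnion] at hq
    obtain ⟨p, hp, S', hS', rfl⟩ := hq
    intro c hc
    have := G.contexts_over p hp c hc
    exact ⟨wordsOver_mono hVV' this.1, wordsOver_mono hVV' this.2⟩
  · intro q hq
    simp only [Set.mem_iUnion] at hq
    obtain ⟨p, hp, S', hS', rfl⟩ := hq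
    exact G.contexts_ne p hp
  · refine G.axs_finite.union (Set.Finite.subset (G.selections_finite.biUnion fun p hp =>
      ((hdiff p hp).prod (G.contexts_finite p hp)).image fun q => q.2.1 ++ q.1 ++ q.2.2) ?_)
    rintro _ ⟨-, p, hp, x, hx, c, hc, rfl⟩
    simp only [Set.mem_iUnion]
    exact ⟨p, hp, (x, c), ⟨hx, hc⟩, rfl⟩
  · rintro w (hw | hw)
    exacts [G.mem_language_of_mem_axs hw, hw.1]
  · intro q hq x hx hxL c hc
    simp only [Set.mem_iUnion] at hq
    obtain ⟨p, hp, S', hS', rfl⟩ := hq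
    exact G.mem_language_of_step hp (hsub p hp S' hS' x hx (hle hxL)) hxL hc
  · intro w hw
    rcases G.mem_axs_or_exists_step hw with h | ⟨p, hp, x, hx, hxL, c, hc, rfl⟩
    · exact Or.inl (Or.inl h)
    · by_cases hex : ∃ S' ∈ 𝒮 p, x ∈ S'
      · obtain ⟨S', hS', hxS'⟩ := hex
        refine Or.inr ⟨(S', p.2), ?_, x, hxS', hxL, c, hc, rfl⟩
        simp only [Set.mem_iUnion]
        exact ⟨p, hp, S', hS', rfl⟩
      · push Not at hex
        exact Or.inl (Or.inr ⟨hw, p, hp, x, ⟨hx, hex⟩, c, hc, rfl⟩)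

/-- The case of `EC_subset_of_replace` in which the new selection languages are languages over the
alphabet of the old one. -/
theorem EC_subset_of_replace_same {F F' : Family α}
    (h : ∀ U : Finset α, U.Nonempty → ∀ S, F U S → ∃ 𝒮 : Set (Language α), 𝒮.Finite ∧
      (∀ S' ∈ 𝒮, F' U S' ∧ S' ≤ S) ∧ {w | w ∈ S ∧ ∀ S' ∈ 𝒮, w ∉ S'}.Finite) :
    EC F ⊆ EC F' := by
  refine EC_subset_of_replace fun V => ⟨V, subset_rfl, fun U hUV hU S hS => ?_⟩
  obtain ⟨𝒮, h1, h2, h3⟩ := h U hU S hS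
  exact ⟨𝒮, h1, fun S' hS' => ⟨U, hU, hUV, (h2 S' hS').1⟩, h3, fun S' hS' w hw _ => (h2 S' hS').2 hw⟩

theorem EC_mono {F F' : Family α} (h : ∀ U L, F U L → F' U L) : EC F ⊆ EC F' :=
  EC_subset_of_replace_same fun U _ S hS =>
    ⟨{S}, Set.finite_singleton _, by rintro _ rfl; exact ⟨h U _ hS, le_rfl⟩, by simp⟩

/-! ### Inclusions between the selection families -/

theorem mul_wordsOver_self (U : Finset α) : wordsOver U * wordsOver U = wordsOver U := by
  apply le_antisymm (mul_le_wordsOver le_rfl le_rfl)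
  exact fun w hw => ⟨[], nil_mem_wordsOver U, w, hw, rfl⟩

theorem kstar_wordsOver (U : Finset α) : (wordsOver U)∗ = wordsOver U := by
  refine kstar_eq_self.2 ⟨mul_wordsOver_self U, ?_⟩
  rintro _ rfl
  exact nil_mem_wordsOver U

theorem MON.nil {U : Finset α} {L : Language α} (h : MON U L) : NIL U L := by
  obtain ⟨h, rfl⟩ := h
  exact ⟨h, Or.inr (by simp)⟩

theorem MON.inf {U : Finset α} {L : Language α} (h : MON U L) : INF U L := by
  obtain ⟨h, rfl⟩ := h
  exact ⟨h, fun _ _ y hy _ _ _ => hy⟩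

theorem MON.star {U : Finset α} {L : Language α} (h : MON U L) : STAR U L := by
  obtain ⟨h, rfl⟩ := h
  exact ⟨h, _, h, (kstar_wordsOver U).symm⟩

theorem INF.suf {U : Finset α} {L : Language α} (h : INF U L) : SUF U L :=
  ⟨h.1, fun x hx y hy hxy => h.2 x hx y hy [] (nil_mem_wordsOver U) (by simpa using hxy)⟩

theorem INF.pre {U : Finset α} {L : Language α} (h : INF U L) : PRE U L :=
  ⟨h.1, fun x hx y hy hxy => h.2 [] (nil_mem_wordsOver U) x hx y hy (by simpa using hxy)⟩

theorem COMM.circ {U : Finset α} {L : Language α} (h : COMM U L) : CIRC U L :=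
  ⟨h.1, fun _ _ hxy => h.2 _ hxy _ List.perm_append_comm⟩

theorem MON.comm {U : Finset α} {L : Language α} (h : MON U L) : COMM U L := by
  obtain ⟨h, rfl⟩ := h
  exact ⟨h, fun w hw w' hp a ha => hw a (hp.mem_iff.2 ha)⟩

theorem MON.nc {U : Finset α} {L : Language α} (h : MON U L) : NC U L := by
  obtain ⟨h, rfl⟩ := h
  refine ⟨h, 1, le_rfl, fun x hx y hy z hz => ?_⟩
  simp [hx, hz, wordPow_mem_wordsOver hy]

theorem MON.sydef {U : Finset α} {L : Language α} (h : MON U L) : SYDEF U L := by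
  obtain ⟨h, rfl⟩ := h
  exact ⟨h, 1, 1, regularOver_one U, regularOver_one U, by simp⟩

theorem MON.ord {U : Finset α} {L : Language α} (h : MON U L) : ORD U L := by
  obtain ⟨h, rfl⟩ := h
  refine ⟨h, Unit, inferInstance, inferInstance, ⟨fun _ _ => (), (), Set.univ⟩,
    fun _ _ _ _ => le_rfl, fun w => ⟨fun _ a ha => ?_, fun _ => Set.mem_univ _⟩⟩
  obtain ⟨b, -, rfl⟩ := List.mem_map.1 ha
  exact b.2

theorem finite_letterWords (X : Finset α) : {w | w ∈ letterWords X}.Finite := by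
  refine (X.finite_toSet.image fun a => [a]).subset ?_
  rintro _ ⟨a, ha, rfl⟩
  exact ⟨a, ha, rfl⟩

theorem letterWords_le {U X : Finset α} (h : X ⊆ U) : letterWords X ≤ wordsOver U := by
  rintro _ ⟨a, ha, rfl⟩
  exact cons_mem_wordsOver.2 ⟨h ha, nil_mem_wordsOver U⟩

theorem regularOver_letterWords {U X : Finset α} (h : X ⊆ U) : RegularOver U (letterWords X) :=
  regularOver_of_finite (finite_letterWords X) (letterWords_le h)

theorem COMB.defn {U : Finset α} {L : Language α} (h : COMB U L) : DEF U L := by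
  obtain ⟨h, X, hX, rfl⟩ := h
  refine ⟨h, 0, letterWords X, bot_le, letterWords_le hX, ?_, finite_letterWords X,
    (zero_add _).symm⟩
  simp

theorem EC_FIN_subset_MON : EC (FIN (α := α)) ⊆ EC MON :=
  EC_subset_of_replace_same fun _ _ _ hS => ⟨∅, Set.finite_empty, by simp, by simpa using hS.2⟩

theorem EC_MON_subset_COMB : EC (MON (α := α)) ⊆ EC COMB := by
  refine EC_subset_of_replace_same fun U _ S hS =>
    ⟨{wordsOver U * letterWords U}, Set.finite_singleton _, ?_, ?_⟩
  · rintro _ rfl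
    refine ⟨⟨(regularOver_wordsOver U).mul (regularOver_letterWords subset_rfl), U, subset_rfl,
      rfl⟩, ?_⟩
    rw [hS.2]
    exact mul_le_wordsOver le_rfl (letterWords_le subset_rfl)
  · refine (Set.finite_singleton []).subset ?_
    rintro w ⟨hw, hw'⟩
    rw [hS.2] at hw
    by_contra hne
    obtain ⟨v, a, rfl⟩ := (List.eq_nil_or_concat' w).resolve_left hne
    simp only [append_mem_wordsOver, cons_mem_wordsOver] at hw
    exact hw' _ rfl ⟨v, hw.1, [a], ⟨a, hw.2.1, rfl⟩, rfl⟩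

/-- The words over `U` of length at least `n`. -/
def longWords (U : Finset α) (n : ℕ) : Language α := {w | w ∈ wordsOver U ∧ n ≤ w.length}

theorem regularOver_longWords (U : Finset α) (n : ℕ) : RegularOver U (longWords U n) := by
  refine ⟨?_, fun w hw => hw.1⟩
  have : longWords U n = wordsOver U ⊓ ({w | w ∈ wordsOver U ∧ w.length < n} : Language α)ᶜ := by
    ext w
    refine ⟨fun h => ⟨h.1, fun h' => absurd h'.2 (not_lt.2 h.2)⟩, fun h => ⟨h.1, ?_⟩⟩
    exact not_lt.1 fun h' => h.2 ⟨h.1, h'⟩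
  rw [this]
  exact (isRegular_wordsOver U).inf (isRegular_of_finite (finite_wordsOver_length_lt U n)).compl

theorem comm_longWords (U : Finset α) (n : ℕ) : COMM U (longWords U n) :=
  ⟨regularOver_longWords U n, fun _ hw _ hp =>
    ⟨fun a ha => hw.1 a (hp.mem_iff.2 ha), hp.length_eq ▸ hw.2⟩⟩

theorem nil_longWords (U : Finset α) (n : ℕ) : NIL U (longWords U n) :=
  ⟨regularOver_longWords U n, Or.inr <| (finite_wordsOver_length_lt U n).subset fun _ hw =>
    ⟨hw.1, not_le.1 fun h => hw.2 ⟨hw.1, h⟩⟩⟩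

theorem defn_longWords (U : Finset α) (n : ℕ) : DEF U (longWords U n) := by
  refine ⟨regularOver_longWords U n, 0, {w | w ∈ wordsOver U ∧ w.length = n}, bot_le,
    fun w hw => hw.1, by simp, ?_, ?_⟩
  · exact (finite_wordsOver_length_lt U (n + 1)).subset fun w hw =>
      ⟨hw.1, by have := hw.2; omega⟩
  · rw [zero_add]
    ext w
    constructor
    · rintro ⟨hw, hn⟩
      rw [← List.take_append_drop (w.length - n) w, append_mem_wordsOver] at hw
      exact ⟨_, hw.1, _, ⟨hw.2, by rw [List.length_drop]; omega⟩, List.take_append_drop _ _⟩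
    · rintro ⟨x, hx, y, ⟨hy, rfl⟩, rfl⟩
      exact ⟨append_mem_wordsOver.2 ⟨hx, hy⟩, by simp⟩

/-- Up to finitely many words, a nilpotent language is empty or consists of all sufficiently long
words. -/
theorem EC_NIL_subset {F : Family α} (hF : ∀ U n, F U (longWords U n)) :
    EC (NIL (α := α)) ⊆ EC F := by
  refine EC_subset_of_replace_same fun U _ S hS => ?_
  rcases hS.2 with h | h
  · exact ⟨∅, Set.finite_empty, by simp, by simpa using h⟩
  · obtain ⟨n, hn⟩ := (h.image List.length).bddAbove
    have hn' : ∀ w ∈ wordsOver U, n < w.length → w ∈ S := fun w hw hlt => by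
      by_contra hwS
      exact absurd (hn ⟨w, ⟨hw, hwS⟩, rfl⟩) (not_le.2 hlt)
    refine ⟨{longWords U (n + 1)}, Set.finite_singleton _, ?_, ?_⟩
    · rintro _ rfl
      exact ⟨hF U _, fun w hw => hn' w hw.1 hw.2⟩
    · refine (finite_wordsOver_length_lt U (n + 1)).subset fun w hw =>
        ⟨hS.1.2 hw.1, not_le.1 fun h => hw.2 _ rfl ⟨hS.1.2 hw.1, h⟩⟩

/-- Up to finitely many words, a definite language is a finite union of languages `U^* b`. -/
theorem EC_DEF_subset {F : Family α}
    (hF : ∀ U, ∀ b ∈ wordsOver U, F U (wordsOver U * {b})) : EC (DEF (α := α)) ⊆ EC F := by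
  refine EC_subset_of_replace_same fun U _ S hS => ?_
  obtain ⟨-, A, B, -, hB, hAfin, hBfin, rfl⟩ := hS
  refine ⟨(fun b : List α => wordsOver U * ({b} : Language α)) '' {w | w ∈ B}, hBfin.image _,
    ?_, hAfin.subset ?_⟩
  · rintro _ ⟨b, hb, rfl⟩
    refine ⟨hF U b (hB hb), ?_⟩
    rintro _ ⟨x, hx, y, rfl, rfl⟩
    exact Or.inr ⟨x, hx, y, hb, rfl⟩
  · rintro w ⟨hw | ⟨x, hx, y, hy, rfl⟩, hw'⟩
    · exact hw
    · exact absurd ⟨x, hx, y, rfl, rfl⟩ (hw' _ ⟨y, hy, rfl⟩)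

theorem sydef_wordsOver_mul_singleton (U : Finset α) (b : List α) (hb : b ∈ wordsOver U) :
    SYDEF U (wordsOver U * {b}) :=
  ⟨(regularOver_wordsOver U).mul (regularOver_singleton hb), 1, {b}, regularOver_one U,
    regularOver_singleton hb, by rw [one_mul]⟩

theorem EC_REG_subset_UF : EC (REG (α := α)) ⊆ EC UF := by
  refine EC_subset_of_replace_same fun U _ S hS => ?_
  obtain ⟨l, hl, rfl⟩ := RegularOver.isUnionFreeSum hS
  have hmem : ∀ w, w ∈ (l.map RegularExpression.matches').sum ↔ ∃ P ∈ l, w ∈ P.matches' := by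
    intro w
    clear hl hS
    induction l with
    | nil => simp
    | cons P l ih =>
      rw [List.map_cons, List.sum_cons, Language.mem_add, ih]
      simp
  refine ⟨{L | ∃ P ∈ l, P.matches' = L}, ?_, ?_, ?_⟩
  · exact ((List.finite_toSet l).image RegularExpression.matches').subset fun L ⟨P, h, h'⟩ =>
      ⟨P, h, h'⟩
  · rintro _ ⟨P, hP, rfl⟩
    have hle : P.matches' ≤ (l.map RegularExpression.matches').sum := fun w hw =>
      (hmem w).2 ⟨P, hP, hw⟩
    exact ⟨⟨⟨isRegular_matches' P, hle.trans hS.2⟩, P, hl P hP, rfl⟩, hle⟩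
  · convert Set.finite_empty
    ext w
    refine ⟨fun ⟨hw, hw'⟩ => ?_, False.elim⟩
    obtain ⟨P, hP, hw⟩ := (hmem w).1 hw
    exact hw' _ ⟨P, hP, rfl⟩ hw

/-- A selection language may be padded by powers of a letter foreign to the grammar: this does not
change which words of the generated language are selected. -/
theorem EC_REG_subset_of_padding [Infinite α] {F : Family α}
    (hF : ∀ (U : Finset α) (S G : Language α) (a : α), RegularOver U S → RegularOver U G →
      G = {[a]} → ∃ S', F U S' ∧ S ≤ S' ∧ ∀ w ∈ S', a ∉ w → w ∈ S) :
    EC (REG (α := α)) ⊆ EC F := by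
  classical
  refine EC_subset_of_replace fun V => ?_
  obtain ⟨a, ha⟩ := V.exists_notMem
  refine ⟨insert a V, Finset.subset_insert a V, fun U hUV hU S hS => ?_⟩
  obtain ⟨S', h1, h2, h3⟩ := hF (insert a U) S {[a]} a
    (regularOver_mono (Finset.subset_insert a U) hS) (regularOver_singleton (by simp)) rfl
  refine ⟨{S'}, Set.finite_singleton _, ?_, ?_, ?_⟩
  · rintro _ rfl
    exact ⟨insert a U, Finset.insert_nonempty _ _, Finset.insert_subset_insert a hUV, h1⟩
  · convert Set.finite_empty
    ext w
    exact ⟨fun ⟨hw, hw'⟩ => hw' _ rfl (h2 hw), False.elim⟩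
  · rintro _ rfl w hw hwV
    exact h3 w hw fun haw => ha (hwV a haw)

theorem eq_nil_of_mem_kstar_letter {a : α} {w : List α} (hw : w ∈ ({[a]} : Language α)∗)
    (ha : a ∉ w) : w = [] := by
  obtain ⟨n, rfl⟩ := mem_kstar_singleton.1 hw
  rw [wordPow_singleton] at ha ⊢
  cases n with
  | zero => rfl
  | succ n => simp [List.replicate_succ] at ha

theorem singleton_letter_ne_zero (a : α) : ({[a]} : Language α) ≠ 0 := fun h => by
  have : [a] ∈ ({[a]} : Language α) := rfl
  rw [h] at this
  exact this

theorem singleton_letter_ne_one (a : α) : ({[a]} : Language α) ≠ 1 := fun h => by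
  have : [a] ∈ ({[a]} : Language α) := rfl
  rw [h] at this
  exact List.cons_ne_nil _ _ this

theorem EC_REG_subset_LCOM [Infinite α] : EC (REG (α := α)) ⊆ EC LCOM := by
  refine EC_REG_subset_of_padding fun U S G a hS hG hGa => ⟨S * G∗, ⟨hS.mul hG.kstar, S, G, hS, hG,
    hGa ▸ singleton_letter_ne_zero a, hGa ▸ singleton_letter_ne_one a, rfl⟩, fun w hw =>
    ⟨w, hw, [], Language.nil_mem_kstar _, by simp⟩, ?_⟩
  rintro _ ⟨x, hx, y, hy, rfl⟩ ha
  obtain rfl := eq_nil_of_mem_kstar_letter (hGa ▸ hy) fun h => ha (List.mem_append_right _ h)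
  change x ++ [] ∈ S
  rwa [List.append_nil]

theorem EC_REG_subset_RCOM [Infinite α] : EC (REG (α := α)) ⊆ EC RCOM := by
  refine EC_REG_subset_of_padding fun U S G a hS hG hGa => ⟨G∗ * S, ⟨hG.kstar.mul hS, G, S, hG, hS,
    hGa ▸ singleton_letter_ne_zero a, hGa ▸ singleton_letter_ne_one a, rfl⟩, fun w hw =>
    ⟨[], Language.nil_mem_kstar _, w, hw, rfl⟩, ?_⟩
  rintro _ ⟨x, hx, y, hy, rfl⟩ ha
  obtain rfl := eq_nil_of_mem_kstar_letter (hGa ▸ hx) fun h => ha (List.mem_append_left _ h)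
  exact hy

theorem EC_REG_subset_TCOM [Infinite α] : EC (REG (α := α)) ⊆ EC TCOM :=
  EC_REG_subset_LCOM.trans <| EC_mono fun U _ ⟨h, E, G, hE, hG, h0, h1, hL⟩ =>
    ⟨h, E, G, 1, hE, hG, regularOver_one U, h0, h1, by rw [hL, mul_one]⟩

/-! ### Power-separating languages -/

theorem exists_iterate_eq_le_card {Z : Type*} [Fintype Z] (f : Z → Z) (z : Z) (i : ℕ) :
    ∃ j ≤ Fintype.card Z, f^[j] z = f^[i] z := by
  classical
  have hex : ∃ j, f^[j] z = f^[i] z := ⟨i, rfl⟩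
  refine ⟨Nat.find hex, ?_, Nat.find_spec hex⟩
  by_contra! hlt
  obtain ⟨a, b, hne, hab⟩ := Fintype.exists_ne_map_eq_of_card_lt
    (fun k : Fin (Nat.find hex) => f^[k] z) (by simpa using hlt)
  wlog h : a < b generalizing a b
  · exact this b a hne.symm hab.symm (lt_of_le_of_ne (not_lt.1 h) hne.symm)
  have hlt' : Nat.find hex - b + a < Nat.find hex := by
    have := b.2; have : (a : ℕ) < b := h; omega
  refine Nat.find_min hex hlt' ?_
  rw [Function.iterate_add_apply, show f^[(a : ℕ)] z = f^[(b : ℕ)] z from hab,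
    ← Function.iterate_add_apply, Nat.sub_add_cancel b.2.le]
  exact Nat.find_spec hex

theorem exists_iterate_eq_ge {Z : Type*} [Fintype Z] (f : Z → Z) (z : Z) {i : ℕ}
    (hi : Fintype.card Z ≤ i) (N : ℕ) : ∃ j ≥ N, f^[j] z = f^[i] z := by
  obtain ⟨a, b, hne, hab⟩ := Fintype.exists_ne_map_eq_of_card_lt
    (fun k : Fin (i + 1) => f^[k] z) (by simpa using Nat.lt_succ_of_le hi)
  wlog h : a < b generalizing a b
  · exact this b a hne.symm hab.symm (lt_of_le_of_ne (not_lt.1 h) hne.symm)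
  have hlt : (a : ℕ) < b := h
  have hb := b.2
  -- `i` lies beyond a repetition, hence on a cycle of length `b - a`
  have key : ∀ k, f^[i + k * (b - a)] z = f^[i] z := by
    intro k
    induction k with
    | zero => simp
    | succ k ih =>
      rw [← ih, show i + (k + 1) * (b - a) = (i - a + k * (b - a)) + b by
          rw [Nat.succ_mul]; omega,
        show i + k * (b - a) = (i - a + k * (b - a)) + a by omega,
        Function.iterate_add_apply, Function.iterate_add_apply _ _ (a : ℕ)]
      exact congrArg _ hab.symm
  refine ⟨i + N * (b - a), ?_, key N⟩
  exact (Nat.le_mul_of_pos_right N (by omega)).trans (Nat.le_add_left _ _)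

theorem DFA_evalFrom_wordPow {σ : Type*} (M : DFA α σ) (x : List α) (s : σ) (n : ℕ) :
    M.evalFrom s (wordPow x n) = (fun t => M.evalFrom t x)^[n] s := by
  induction n generalizing s with
  | zero => rfl
  | succ n ih => rw [wordPow_succ, DFA.evalFrom_of_append, ih, Function.iterate_succ_apply]

/-- Pumping a leading power of a word up or down. -/
theorem exists_pumping_bound {L : Language α} (hL : L.IsRegular) :
    ∃ p : ℕ, ∀ (x : List α) (i : ℕ),
      (∃ j ≤ p, ∀ y, wordPow x j ++ y ∈ L ↔ wordPow x i ++ y ∈ L) ∧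
      (p ≤ i → ∀ N, ∃ j ≥ N, ∀ y, wordPow x j ++ y ∈ L ↔ wordPow x i ++ y ∈ L) := by
  obtain ⟨σ, _, M, rfl⟩ := hL
  refine ⟨Fintype.card σ, fun x i => ⟨?_, fun hi N => ?_⟩⟩
  · obtain ⟨j, hj, h⟩ := exists_iterate_eq_le_card (fun t => M.evalFrom t x) M.start i
    refine ⟨j, hj, fun y => ?_⟩
    simp only [DFA.mem_accepts, DFA.eval, DFA.evalFrom_of_append, DFA_evalFrom_wordPow, h]
  · obtain ⟨j, hj, h⟩ := exists_iterate_eq_ge (fun t => M.evalFrom t x) M.start hi N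
    refine ⟨j, hj, fun y => ?_⟩
    simp only [DFA.mem_accepts, DFA.eval, DFA.evalFrom_of_append, DFA_evalFrom_wordPow, h]

theorem PS_of_forall {U : Finset α} {L : Language α} (hL : RegularOver U L) (p : ℕ)
    (h : ∀ x ∈ wordsOver U, ∀ n ≥ p, wordPow x n ∈ L → ∀ m ≥ p, wordPow x m ∈ L) : PS U L := by
  refine ⟨hL, p + 1, by omega, fun x hx => ?_⟩
  by_cases hn : ∃ n ≥ p, wordPow x n ∈ L
  · obtain ⟨n, hn, hxn⟩ := hn
    exact Or.inr fun m hm => h x hx n hn hxn m (by omega)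
  · push Not at hn
    exact Or.inl fun m hm => hn m (by omega)

theorem SUF.ps {U : Finset α} {L : Language α} (h : SUF U L) : PS U L := by
  obtain ⟨p, hp⟩ := exists_pumping_bound h.1.1
  refine PS_of_forall h.1 p fun x hx n hn hxn m _ => ?_
  obtain ⟨j, hj, hiff⟩ := (hp x n).2 hn m
  have := (hiff []).2 (by simpa using hxn)
  rw [List.append_nil, ← Nat.sub_add_cancel hj, wordPow_add] at this
  exact h.2 _ (wordPow_mem_wordsOver hx _) _ (wordPow_mem_wordsOver hx _) this

theorem PRE.ps {U : Finset α} {L : Language α} (h : PRE U L) : PS U L := by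
  obtain ⟨p, hp⟩ := exists_pumping_bound h.1.1
  refine PS_of_forall h.1 p fun x hx n hn hxn m _ => ?_
  obtain ⟨j, hj, hiff⟩ := (hp x n).2 hn m
  have := (hiff []).2 (by simpa using hxn)
  rw [List.append_nil, ← Nat.add_sub_cancel' hj, wordPow_add] at this
  exact h.2 _ (wordPow_mem_wordsOver hx _) _ (wordPow_mem_wordsOver hx _) this

theorem NC.ps {U : Finset α} {L : Language α} (h : NC U L) : PS U L := by
  obtain ⟨hL, k, -, hk⟩ := h
  have key : ∀ x ∈ wordsOver U, ∀ n ≥ k, wordPow x n ∈ L ↔ wordPow x k ∈ L := by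
    intro x hx n hn
    induction n, hn using Nat.le_induction with
    | base => rfl
    | succ n hn ih =>
      have := hk _ (wordPow_mem_wordsOver hx (n - k)) x hx [] (nil_mem_wordsOver U)
      simp only [List.append_nil, ← wordPow_add] at this
      rw [← ih, show n + 1 = n - k + (k + 1) by omega, ← this, Nat.sub_add_cancel hn]
  exact PS_of_forall hL k fun x hx n hn hxn m hm => (key x hx m hm).2 ((key x hx n hn).1 hxn)

theorem eq_wordPow_append_of_append_eq {x e y : List α} {n : ℕ} (h : e ++ y = wordPow x n) :
    ∃ i r r', e = wordPow x i ++ r ∧ r ++ r' = x := by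
  induction n generalizing e with
  | zero =>
    obtain ⟨rfl, rfl⟩ := List.append_eq_nil_iff.1 h
    exact ⟨0, [], x, rfl, rfl⟩
  | succ n ih =>
    rw [wordPow_succ] at h
    rcases List.append_eq_append_iff.1 h with ⟨v, rfl, -⟩ | ⟨v, rfl, hv⟩
    · exact ⟨0, e, v, rfl, rfl⟩
    · obtain ⟨i, r, r', rfl, hr⟩ := ih hv.symm
      exact ⟨i + 1, r, r', by simp [wordPow_succ], hr⟩

/-- If some power of `x` has a prefix in a regular language, then so has a power with a bounded
exponent. -/
theorem exists_prefix_wordPow_bound {E : Language α} (hE : E.IsRegular) :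
    ∃ p : ℕ, ∀ x n, (∃ e ∈ E, e <+: wordPow x n) → ∃ e ∈ E, e <+: wordPow x p := by
  obtain ⟨p, hp⟩ := exists_pumping_bound hE
  refine ⟨p + 1, ?_⟩
  rintro x n ⟨e, he, y, hy⟩
  obtain ⟨i, r, r', rfl, hr⟩ := eq_wordPow_append_of_append_eq hy
  obtain ⟨j, hj, hiff⟩ := (hp x i).1
  refine ⟨_, (hiff r).2 he, r' ++ wordPow x (p - j), ?_⟩
  rw [show p + 1 = j + (1 + (p - j)) by omega, wordPow_add, wordPow_add, ← hr]
  simp [wordPow]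

theorem reverse_wordPow (x : List α) (n : ℕ) : (wordPow x n).reverse = wordPow x.reverse n := by
  induction n with
  | zero => rfl
  | succ n ih => rw [wordPow_succ, List.reverse_append, ih, wordPow_succ']

theorem exists_suffix_wordPow_bound {H : Language α} (hH : H.IsRegular) :
    ∃ p : ℕ, ∀ x n, (∃ h ∈ H, h <:+ wordPow x n) → ∃ h ∈ H, h <:+ wordPow x p := by
  obtain ⟨p, hp⟩ := exists_prefix_wordPow_bound hH.reverse
  refine ⟨p, ?_⟩
  rintro x n ⟨h, hh, hsuf⟩
  obtain ⟨e, he, hpre⟩ := hp x.reverse n ⟨h.reverse, by simpa using hh, by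
    rw [← reverse_wordPow]; exact List.reverse_prefix.2 hsuf⟩
  refine ⟨e.reverse, he, ?_⟩
  rw [← List.reverse_prefix, List.reverse_reverse, reverse_wordPow]
  exact hpre

/-- If `x^n` lies in `E U^* H`, then long powers of `x` have a prefix in `E` and a suffix in `H` that
do not overlap. -/
theorem SYDEF.ps {U : Finset α} {L : Language α} (h : SYDEF U L) : PS U L := by
  obtain ⟨hL, E, H, hE, hH, rfl⟩ := h
  obtain ⟨p, hp⟩ := exists_prefix_wordPow_bound hE.1
  obtain ⟨q, hq⟩ := exists_suffix_wordPow_bound hH.1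
  refine PS_of_forall hL (p + q) fun x hx n hn hxn m hm => ?_
  obtain ⟨_, ⟨e, he, v, hv, rfl⟩, h, hh, hevh⟩ := hxn
  obtain ⟨e', he', y, hy⟩ := hp x n ⟨e, he, v ++ h, by simpa using hevh⟩
  obtain ⟨h', hh', y', hy'⟩ := hq x n ⟨h, hh, e ++ v, hevh⟩
  have h1 := wordPow_mem_wordsOver hx p
  have h2 := wordPow_mem_wordsOver hx q
  rw [← hy, append_mem_wordsOver] at h1
  rw [← hy', append_mem_wordsOver] at h2
  refine ⟨e' ++ (y ++ wordPow x (m - p - q) ++ y'), ⟨e', he', _, ?_, rfl⟩, h', hh', ?_⟩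
  · exact append_mem_wordsOver.2
      ⟨append_mem_wordsOver.2 ⟨h1.2, wordPow_mem_wordsOver hx _⟩, h2.1⟩
  · rw [show m = p + (m - p - q) + q by omega, wordPow_add, wordPow_add, ← hy, ← hy']
    simp [show p + (m - p - q) + q - p - q = m - p - q by omega]

/-! ### Ordered automata -/

/-- The automaton of an ordered language, completed by a least state as a sink for the letters
outside the alphabet. -/
theorem ORD.exists_monotone_DFA {U : Finset α} {L : Language α} (h : ORD U L) :
    ∃ (Z : Type) (_ : Fintype Z) (_ : LinearOrder Z) (M : DFA α Z),
      (∀ a, Monotone fun z => M.step z a) ∧ M.accepts = L := by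
  classical
  obtain ⟨hL, Z, _, _, M, hM, hacc⟩ := h
  let M' : DFA α (WithBot Z) :=
    { step := fun z a => if ha : a ∈ U then z.map (fun t => M.step t ⟨a, ha⟩) else ⊥
      start := M.start
      accept := {z | ∃ t ∈ M.accept, z = (t : WithBot Z)} }
  have hbot : ∀ w, M'.evalFrom ⊥ w = ⊥ := by
    intro w
    induction w with
    | nil => rfl
    | cons a w ih =>
      rw [DFA.evalFrom_cons, show M'.step ⊥ a = ⊥ by simp [M']]
      exact ih
  have hcoe : ∀ (w : List {a // a ∈ U}) (t : Z),
      M'.evalFrom t (w.map Subtype.val) = (M.evalFrom t w : WithBot Z) := by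
    intro w
    induction w with
    | nil => intro t; rfl
    | cons a w ih =>
      intro t
      rw [List.map_cons, DFA.evalFrom_cons, DFA.evalFrom_cons, ← ih]
      simp [M', a.2]
  have hout : ∀ (w : List α) (z : WithBot Z), w ∉ wordsOver U → M'.evalFrom z w = ⊥ := by
    intro w
    induction w with
    | nil => intro z h; simp at h
    | cons a w ih =>
      intro z h
      rw [DFA.evalFrom_cons]
      by_cases ha : a ∈ U
      · exact ih _ fun hw => h (cons_mem_wordsOver.2 ⟨ha, hw⟩)
      · rw [show M'.step z a = ⊥ by simp [M', ha]]
        exact hbot w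
  refine ⟨WithBot Z, inferInstance, inferInstance, M', fun a => ?_, ?_⟩
  · by_cases ha : a ∈ U
    · simpa [M', ha] using (hM ⟨a, ha⟩).withBot_map
    · simpa [M', ha] using monotone_const
  · ext w
    by_cases hw : w ∈ wordsOver U
    · replace hw : ∀ a ∈ w, a ∈ U := hw
      have hmap : (w.attachWith (· ∈ U) hw).map Subtype.val = w := by simp
      rw [DFA.mem_accepts, DFA.eval, ← hmap, ← hacc]
      change M'.evalFrom (M.start : WithBot Z) _ ∈ _ ↔ _
      rw [hcoe]
      constructor
      · rintro ⟨t, ht, heq⟩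
        rw [DFA.mem_accepts, DFA.eval, WithBot.coe_injective heq]
        exact ht
      · exact fun h => ⟨_, h, rfl⟩
    · rw [DFA.mem_accepts, DFA.eval, hout w _ hw]
      refine ⟨fun ⟨t, _, ht⟩ => absurd ht.symm WithBot.coe_ne_bot, fun h => absurd (hL.2 h) hw⟩

/-- Iterating a monotone map of a finite chain stabilizes. -/
theorem Monotone.iterate_card_eq {Z : Type*} [Fintype Z] [LinearOrder Z] {f : Z → Z}
    (hf : Monotone f) (z : Z) : f^[Fintype.card Z] z = f^[Fintype.card Z + 1] z := by
  obtain ⟨a, b, hne, hab⟩ := Fintype.exists_ne_map_eq_of_card_lt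
    (fun k : Fin (Fintype.card Z + 1) => f^[k] z) (by simp)
  wlog h : a < b generalizing a b
  · exact this b a hne.symm hab.symm (lt_of_le_of_ne (not_lt.1 h) hne.symm)
  have hlt : (a : ℕ) + 1 ≤ b := h
  have hfix : f^[(a : ℕ)] z = f^[(a : ℕ) + 1] z := by
    replace hab : f^[(a : ℕ)] z = f^[(b : ℕ)] z := hab
    rcases le_total z (f z) with hz | hz
    · have := hf.monotone_iterate_of_le_map hz
      exact le_antisymm (this (Nat.le_succ _)) (hab ▸ this hlt)
    · have := hf.antitone_iterate_of_map_le hz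
      exact le_antisymm (hab ▸ this hlt) (this (Nat.le_succ _))
  have ha : (a : ℕ) ≤ Fintype.card Z := Nat.lt_succ_iff.1 a.2
  rw [show Fintype.card Z = Fintype.card Z - a + a by omega, Function.iterate_add_apply, add_assoc,
    Function.iterate_add_apply, hfix]

theorem monotone_evalFrom {Z : Type*} [Preorder Z] {M : DFA α Z}
    (hM : ∀ a, Monotone fun z => M.step z a) (w : List α) : Monotone fun z => M.evalFrom z w := by
  induction w with
  | nil => exact monotone_id
  | cons a w ih => exact ih.comp (hM a)

theorem ORD.nc {U : Finset α} {L : Language α} (h : ORD U L) : NC U L := by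
  obtain ⟨Z, _, _, M, hM, rfl⟩ := h.exists_monotone_DFA
  have : Nonempty Z := ⟨M.start⟩
  refine ⟨h.1, Fintype.card Z, Fintype.card_pos, fun x _ y _ z _ => ?_⟩
  simp only [DFA.mem_accepts, DFA.eval, DFA.evalFrom_of_append, DFA_evalFrom_wordPow]
  rw [Monotone.iterate_card_eq (monotone_evalFrom hM y)]

theorem take_le_take_of_le {β : Type*} [LinearOrder β] {l l' : List β} (h : l ≤ l') (k : ℕ) :
    l.take k ≤ l'.take k := by
  rcases h.lt_or_eq with hlt | rfl
  · clear h
    replace hlt : List.Lex (· < ·) l l' := hlt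
    induction hlt generalizing k with
    | nil =>
      cases k with
      | zero => simp
      | succ k => exact le_of_lt (show List.Lex (· < ·) _ _ from .nil)
    | rel h =>
      cases k with
      | zero => simp
      | succ k => exact le_of_lt (show List.Lex (· < ·) _ _ from .rel h)
    | cons _ ih =>
      cases k with
      | zero => simp
      | succ k => exact List.cons_le_cons _ (ih k)
  · exact le_rfl

/-- The automaton that stores the last `|b|` letters read, the most recent one first, is ordered by
the lexicographic order of its states. -/
theorem ord_wordsOver_mul_singleton (U : Finset α) (b : List α) (hb : b ∈ wordsOver U) :
    ORD U (wordsOver U * {b}) := by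
  refine ⟨(regularOver_wordsOver U).mul (regularOver_singleton hb), ?_⟩
  let e := Fintype.equivFin {a // a ∈ U}
  let n := Fintype.card {a // a ∈ U}
  let Z := {l : List (Fin n) // l.length ≤ b.length}
  have : Fintype Z := (List.finite_length_le (Fin n) b.length).fintype
  replace hb : ∀ a ∈ b, a ∈ U := hb
  let b' := b.attachWith (· ∈ U) hb
  have hb' : b'.map Subtype.val = b := by simp [b']
  let M : DFA {a // a ∈ U} Z :=
    { step := fun l a => ⟨(e a :: l.1).take b.length, by simp⟩
      start := ⟨[], by simp⟩
      accept := {l | l.1 = (b'.map e).reverse} }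
  have heval : ∀ w : List {a // a ∈ U}, (M.eval w).1 = ((w.map e).reverse).take b.length := by
    intro w
    induction w using List.reverseRecOn with
    | nil => simp [M, DFA.eval]
    | append_singleton w a ih =>
      rw [DFA.eval_append_singleton]
      change (e a :: (M.eval w).1).take b.length = _
      rw [ih]
      simp only [List.map_append, List.map_cons, List.map_nil, List.reverse_append,
        List.reverse_cons, List.reverse_nil, List.nil_append, List.cons_append]
      cases b.length with
      | zero => simp
      | succ k => simp [List.take_take]
  refine ⟨Z, inferInstance, inferInstance, M, fun a l l' h => ?_, fun w => ?_⟩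
  · exact take_le_take_of_le (List.cons_le_cons _ h) _
  · have h1 : w ∈ M.accepts ↔ b'.map e <:+ w.map e := by
      rw [← List.reverse_prefix, List.prefix_iff_eq_take]
      change (M.eval w).1 = _ ↔ _
      rw [heval]
      simp [b', eq_comm]
    rw [h1]
    constructor
    · rintro ⟨v, hv⟩
      have := congrArg (List.map (Subtype.val ∘ e.symm)) hv
      simp only [List.map_append, List.map_map, Function.comp_assoc, Equiv.symm_comp_self,
        Function.comp_id] at this
      rw [hb'] at this
      exact ⟨_, fun a ha => by obtain ⟨c, -, rfl⟩ := List.mem_map.1 ha; exact (e.symm c).2,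
        b, rfl, this⟩
    · rintro ⟨v, hv, _, rfl, h⟩
      replace hv : ∀ a ∈ v, a ∈ U := hv
      refine ⟨(v.attachWith (· ∈ U) hv).map e, ?_⟩
      rw [← List.map_append]
      congr 1
      apply List.map_injective_iff.2 Subtype.val_injective
      rw [List.map_append, hb', ← h]
      simp

theorem EC_DEF_subset_ORD : EC (DEF (α := α)) ⊆ EC ORD :=
  EC_DEF_subset ord_wordsOver_mul_singleton

theorem EC_DEF_subset_SYDEF : EC (DEF (α := α)) ⊆ EC SYDEF :=
  EC_DEF_subset sydef_wordsOver_mul_singleton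

/-! ### Long words of a generated language -/

/-- All long words of a generated language arise by a step with one of finitely many selection
languages and contexts `(S, u, v)` of bounded length, and the language is closed under such
steps. -/
theorem exists_contexts_of_mem_EC {F : Family α} {L : Language α} (hL : L ∈ EC F) :
    ∃ (𝒟 : Set (Language α × List α × List α)) (N : ℕ), 𝒟.Finite ∧
      (∀ d ∈ 𝒟, (∃ U, F U d.1) ∧ d.2.1 ++ d.2.2 ≠ [] ∧ (d.2.1 ++ d.2.2).length ≤ N ∧
        ∀ y ∈ d.1, y ∈ L → d.2.1 ++ y ++ d.2.2 ∈ L) ∧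
      ∀ w ∈ L, N < w.length → ∃ d ∈ 𝒟, ∃ x ∈ d.1, x ∈ L ∧ w = d.2.1 ++ x ++ d.2.2 := by
  obtain ⟨G, rfl⟩ := hL
  have hfin : (⋃ p ∈ G.selections, (fun c => (p.1, c)) '' p.2).Finite :=
    G.selections_finite.biUnion fun p hp => (G.contexts_finite p hp).image _
  obtain ⟨N₁, hN₁⟩ := (hfin.image fun d => (d.2.1 ++ d.2.2).length).bddAbove
  obtain ⟨N₂, hN₂⟩ := (G.axs_finite.image List.length).bddAbove
  refine ⟨_, max N₁ N₂, hfin, fun d hd => ⟨?_, ?_, ?_, ?_⟩, fun w hw hlen => ?_⟩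
  · simp only [Set.mem_iUnion] at hd
    obtain ⟨p, hp, c, hc, rfl⟩ := hd
    obtain ⟨U, -, -, hU⟩ := G.selection_mem p hp
    exact ⟨U, hU⟩
  · simp only [Set.mem_iUnion] at hd
    obtain ⟨p, hp, c, hc, rfl⟩ := hd
    exact G.contexts_ne p hp c hc
  · exact (hN₁ ⟨d, hd, rfl⟩).trans (le_max_left _ _)
  · simp only [Set.mem_iUnion] at hd
    obtain ⟨p, hp, c, hc, rfl⟩ := hd
    exact fun y hy hyL => G.mem_language_of_step hp hy hyL hc
  · rcases G.mem_axs_or_exists_step hw with h | ⟨p, hp, x, hx, hxL, c, hc, rfl⟩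
    · exact absurd ((hN₂ ⟨w, h, rfl⟩).trans (le_max_right _ _)) (not_le.2 hlen)
    · refine ⟨(p.1, c), ?_, x, hx, hxL, rfl⟩
      simp only [Set.mem_iUnion]
      exact ⟨p, hp, c, hc, rfl⟩

/-! ### Reduction to coverings of a single language -/

/-- Up to finitely many words, `T` is a finite union of languages `u (S ∩ A^*) v` with `S` in the
family `F`. The triples `(S, u, v)` are collected in a finite set; the bound `N` serves both for the
exceptional words and for the lengths of `u` and `v`. -/
def FinitelyCovered (F : Family α) (A : Finset α) (T : Language α) : Prop :=
  ∃ (𝒟 : Set (Language α × List α × List α)) (N : ℕ), 𝒟.Finite ∧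
    (∀ d ∈ 𝒟, (∃ U, F U d.1) ∧ d.2.1.length ≤ N ∧ d.2.2.length ≤ N ∧
      ∀ y ∈ d.1, y ∈ wordsOver A → d.2.1 ++ y ++ d.2.2 ∈ T) ∧
    ∀ t ∈ T, N ≤ t.length → ∃ d ∈ 𝒟, ∃ x ∈ d.1, t = d.2.1 ++ x ++ d.2.2

/-- All words over `A`, together with the words of `T` enclosed by two copies of a marker `c`. -/
def markedLanguage (A : Finset α) (c : α) (T : Language α) : Language α :=
  {w | w ∈ wordsOver A ∨ ∃ t ∈ T, w = c :: t ++ [c]}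

theorem markedLanguage_mem_EC {F : Family α} {A : Finset α} (hA : A.Nonempty) {c : α} (hc : c ∉ A)
    {T : Language α} (hT : T ≤ wordsOver A) (hFA : F A (wordsOver A)) (hFT : F A T) :
    markedLanguage A c T ∈ EC F := by
  classical
  have hAc : A ⊆ insert c A := Finset.subset_insert c A
  have hnot : ∀ t : List α, c :: t ++ [c] ∉ wordsOver A := fun t h =>
    hc (cons_mem_wordsOver.1 h).1
  refine mem_EC_of_closed (insert c A) (Finset.insert_nonempty c A) ?_
    {(wordsOver A, (fun a => ([], [a])) '' (A : Set α)), (T, {([c], [c])})} (by simp) ?_ ?_ ?_ ?_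
    {[]} (Set.finite_singleton _) ?_ ?_ ?_
  · rintro w (hw | ⟨t, ht, rfl⟩)
    · exact wordsOver_mono hAc hw
    · have := wordsOver_mono hAc (hT ht)
      refine append_mem_wordsOver.2 ⟨cons_mem_wordsOver.2 ⟨by simp, this⟩, ?_⟩
      exact cons_mem_wordsOver.2 ⟨by simp, nil_mem_wordsOver _⟩
  · rintro p (rfl | rfl)
    exacts [⟨A, hA, hAc, hFA⟩, ⟨A, hA, hAc, hFT⟩]
  · rintro p (rfl | rfl)
    exacts [A.finite_toSet.image _, Set.finite_singleton _]
  · rintro p (rfl | rfl) d hd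
    · obtain ⟨a, ha, rfl⟩ := hd
      exact ⟨nil_mem_wordsOver _, cons_mem_wordsOver.2 ⟨hAc ha, nil_mem_wordsOver _⟩⟩
    · obtain rfl := hd
      have : [c] ∈ wordsOver (insert c A) := cons_mem_wordsOver.2 ⟨by simp, nil_mem_wordsOver _⟩
      exact ⟨this, this⟩
  · rintro p (rfl | rfl) d hd
    · obtain ⟨a, ha, rfl⟩ := hd
      simp
    · obtain rfl := hd
      simp
  · rintro _ rfl
    exact Or.inl (nil_mem_wordsOver A)
  · rintro p (rfl | rfl) x hx hxL d hd
    · obtain ⟨a, ha, rfl⟩ := hd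
      exact Or.inl (append_mem_wordsOver.2 ⟨hx, cons_mem_wordsOver.2 ⟨ha, nil_mem_wordsOver A⟩⟩)
    · obtain rfl := hd
      exact Or.inr ⟨x, hx, rfl⟩
  · rintro w (hw | ⟨t, ht, rfl⟩)
    · rcases List.eq_nil_or_concat' w with rfl | ⟨v, a, rfl⟩
      · exact Or.inl rfl
      · rw [append_mem_wordsOver, cons_mem_wordsOver] at hw
        exact Or.inr ⟨_, Or.inl rfl, v, hw.1, Or.inl hw.1, ([], [a]), ⟨a, hw.2.1, rfl⟩, rfl⟩
    · exact Or.inr ⟨_, Or.inr rfl, t, ht, Or.inl (hT ht), _, rfl, rfl⟩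

/-- A long word `c t c` can only be derived from an infix `x` of `t`, by a context `(cu, vc)`. -/
theorem finitelyCovered_of_markedLanguage_mem_EC {F : Family α} {A : Finset α} {c : α} (hc : c ∉ A)
    {T : Language α} (hT : T ≤ wordsOver A) (h : markedLanguage A c T ∈ EC F) :
    FinitelyCovered F A T := by
  classical
  obtain ⟨𝒟, N, hfin, h𝒟, hlong⟩ := exists_contexts_of_mem_EC h
  have hcount : ∀ w ∈ wordsOver A, w.count c = 0 := fun w hw =>
    List.count_eq_zero.2 fun h => hc (hw c h)
  let φ : Language α × List α × List α → Language α × List α × List α :=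
    fun d => (d.1, c :: d.2.1, d.2.2 ++ [c])
  have hφ : Function.Injective φ := by
    rintro ⟨S, u, v⟩ ⟨S', u', v'⟩ h
    simpa [φ] using h
  refine ⟨φ ⁻¹' 𝒟, N, hfin.preimage hφ.injOn, fun d hd => ?_, fun t ht htN => ?_⟩
  · obtain ⟨hF, -, hlen, hcl⟩ := h𝒟 _ hd
    simp only [φ, List.length_append, List.length_cons, List.length_nil] at hlen
    refine ⟨hF, by omega, by omega, fun y hy hyA => ?_⟩
    rcases hcl y hy (Or.inl hyA) with h | ⟨t, ht, h⟩
    · exact absurd (h c (by simp [φ])) hc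
    · have : d.2.1 ++ y ++ d.2.2 = t := by
        simp only [φ, List.cons_append, List.cons.injEq, true_and, ← List.append_assoc] at h
        exact List.append_cancel_right h
      exact this ▸ ht
  · obtain ⟨⟨S, u, v⟩, hd, x, hx, hxL, heq⟩ := hlong _ (Or.inr ⟨t, ht, rfl⟩) (by simp; omega)
    obtain ⟨-, hne, hlen, -⟩ := h𝒟 _ hd
    simp only at hne hlen heq hx
    have htc := hcount t (hT ht)
    rcases hxL with hxA | ⟨t', ht', rfl⟩
    · have hx0 := hcount x hxA
      have hxne : x ≠ [] := by
        rintro rfl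
        have := congrArg List.length heq
        simp at this hlen
        omega
      rcases u with _ | ⟨c', u⟩
      · obtain ⟨e, x, rfl⟩ := List.exists_cons_of_ne_nil hxne
        simp only [List.nil_append, List.cons_append, List.cons.injEq] at heq
        exact absurd (heq.1 ▸ (cons_mem_wordsOver.1 hxA).1) hc
      rcases List.eq_nil_or_concat' v with rfl | ⟨v, e, rfl⟩
      · obtain ⟨x, e, rfl⟩ := (List.eq_nil_or_concat' x).resolve_left hxne
        rw [List.append_nil, ← List.append_assoc] at heq
        obtain rfl : c = e := by simpa using (List.append_inj' heq rfl).2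
        exact absurd (hxA c (by simp)) hc
      · simp only [List.cons_append, List.cons.injEq] at heq
        obtain ⟨rfl, heq⟩ := heq
        rw [← List.append_assoc] at heq
        obtain ⟨rfl, h2⟩ := List.append_inj' heq rfl
        obtain rfl : c = e := by simpa using h2
        exact ⟨(S, u, v), hd, x, hx, rfl⟩
    · exfalso
      have h0 := congrArg (List.count c) heq
      have h1 := hcount t' (hT ht')
      simp only [List.count_append, List.count_cons_self, List.count_nil] at h0
      rcases u with _ | ⟨c', u⟩
      · rcases List.eq_nil_or_concat' v with rfl | ⟨v, e, rfl⟩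
        · exact hne rfl
        · have : e = c := by
            rw [← List.append_assoc] at heq
            have := (List.append_inj' heq rfl).2
            simpa using this.symm
          subst this
          simp at h0
          omega
      · have : c = c' := by
          simp only [List.cons_append, List.cons.injEq] at heq
          exact heq.1
        subst this
        simp at h0
        omega

theorem not_EC_subset_of_not_finitelyCovered [Infinite α] {F F' : Family α} {A : Finset α}
    (hA : A.Nonempty) {T : Language α} (hT : T ≤ wordsOver A) (hFA : F A (wordsOver A))
    (hFT : F A T) (h : ¬ FinitelyCovered F' A T) : ¬ EC F ⊆ EC F' := by
  obtain ⟨c, hc⟩ := A.exists_notMem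
  exact fun hsub => h (finitelyCovered_of_markedLanguage_mem_EC hc hT
    (hsub (markedLanguage_mem_EC hA hc hT hFA hFT)))

/-- In a factorization `p m s` of a word of a covered language, with `p` and `s` long, the part `m`
lies within the selected word. -/
theorem FinitelyCovered.exists_middle {F : Family α} {A : Finset α} {T : Language α}
    (h : FinitelyCovered F A T) :
    ∃ (𝒮 : Set (Language α)) (N : ℕ), 𝒮.Finite ∧ (∀ S ∈ 𝒮, ∃ U, F U S) ∧
      ∀ p m s : List α, N < p.length → N < s.length → p ++ m ++ s ∈ T →
        ∃ S ∈ 𝒮, ∃ u p' s' v, p = u ++ p' ∧ s = s' ++ v ∧ p' ≠ [] ∧ s' ≠ [] ∧ p' ++ m ++ s' ∈ S ∧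
          ∀ y ∈ S, y ∈ wordsOver A → u ++ y ++ v ∈ T := by
  obtain ⟨𝒟, N, hfin, h𝒟, hlong⟩ := h
  refine ⟨Prod.fst '' 𝒟, N, hfin.image _, ?_, fun p m s hp hs hT => ?_⟩
  · rintro _ ⟨d, hd, rfl⟩
    exact (h𝒟 d hd).1
  · obtain ⟨⟨S, u, v⟩, hd, x, hx, heq⟩ := hlong _ hT (by simp; omega)
    obtain ⟨-, hu, hv, hcl⟩ := h𝒟 _ hd
    simp only at hu hv heq hx hcl
    rw [List.append_assoc, List.append_assoc] at heq
    obtain ⟨p', rfl, h1⟩ : ∃ p', p = u ++ p' ∧ p' ++ (m ++ s) = x ++ v := by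
      rcases List.append_eq_append_iff.1 heq with ⟨q, rfl, h1⟩ | ⟨q, rfl, h1⟩
      · rw [List.length_append] at hu; omega
      · exact ⟨q, rfl, h1.symm⟩
    obtain ⟨s', rfl, h2⟩ : ∃ s', s = s' ++ v ∧ p' ++ m ++ s' = x := by
      rw [← List.append_assoc] at h1
      rcases List.append_eq_append_iff.1 h1 with ⟨q, h2, h3⟩ | ⟨q, h2, rfl⟩
      · exact ⟨q, h3, h2.symm⟩
      · simp at hv; omega
    refine ⟨S, ⟨_, hd, rfl⟩, u, p', s', v, rfl, rfl, ?_, ?_, h2 ▸ hx, hcl⟩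
    · rintro rfl
      simp at hp; omega
    · rintro rfl
      simp at hs; omega

/-! ### Separations by short selected words -/

theorem not_EC_MON_subset_FIN [Infinite α] : ¬ EC (MON (α := α)) ⊆ EC FIN := by
  obtain ⟨a, -⟩ := (∅ : Finset α).exists_notMem
  have hmem : wordsOver {a} ∈ EC (MON (α := α)) := by
    refine mem_EC_of_closed {a} (by simp) le_rfl {(wordsOver {a}, {([], [a])})} (by simp)
      ?_ ?_ ?_ ?_ {[]} (by simp) ?_ ?_ ?_
    · rintro _ rfl
      exact ⟨{a}, by simp, subset_rfl, regularOver_wordsOver _, rfl⟩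
    · rintro _ rfl
      exact Set.finite_singleton _
    · rintro _ rfl _ rfl
      exact ⟨nil_mem_wordsOver _, cons_mem_wordsOver.2 ⟨by simp, nil_mem_wordsOver _⟩⟩
    · rintro _ rfl _ rfl
      simp
    · rintro _ rfl
      exact nil_mem_wordsOver _
    · rintro _ rfl x hx - _ rfl
      exact append_mem_wordsOver.2 ⟨hx, cons_mem_wordsOver.2 ⟨by simp, nil_mem_wordsOver _⟩⟩
    · intro w hw
      rcases List.eq_nil_or_concat' w with rfl | ⟨v, b, rfl⟩
      · exact Or.inl rfl
      · rw [append_mem_wordsOver, cons_mem_wordsOver, Finset.mem_singleton] at hw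
        obtain ⟨hv, rfl, -⟩ := hw
        exact Or.inr ⟨_, rfl, v, hv, hv, _, rfl, rfl⟩
  intro hsub
  obtain ⟨𝒟, N, hfin, h𝒟, hlong⟩ := exists_contexts_of_mem_EC (hsub hmem)
  have hf : (⋃ d ∈ 𝒟, (fun x => d.2.1 ++ x ++ d.2.2) '' {w | w ∈ d.1}).Finite :=
    hfin.biUnion fun d hd => by
      obtain ⟨⟨U, hU⟩, -⟩ := h𝒟 d hd
      exact hU.2.image _
  obtain ⟨M, hM⟩ := (hf.image List.length).bddAbove
  obtain ⟨d, hd, x, hx, -, h⟩ := hlong (List.replicate (N + M + 1) a)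
    (replicate_mem_wordsOver (by simp) _) (by simp)
  have := hM ⟨List.replicate (N + M + 1) a, by
    simp only [Set.mem_iUnion]; exact ⟨d, hd, x, hx, h.symm⟩, rfl⟩
  simp at this

theorem exists_ne_letters (α : Type u) [Infinite α] : ∃ a b c : α, a ≠ b ∧ a ≠ c ∧ b ≠ c := by
  let f := Infinite.natEmbedding α
  exact ⟨f 0, f 1, f 2, by simp, by simp, by simp⟩

/-- The language `{λ} ∪ a^* b`. -/
def emptyOrStarLetter (a b : α) : Language α := {w | w = [] ∨ ∃ n, w = List.replicate n a ++ [b]}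

theorem emptyOrStarLetter_mem_EC [DecidableEq α] {F : Family α} {a b : α} {S : Language α}
    (hF : F {a, b} S) (h0 : [] ∉ S) (hS : ∀ n, List.replicate n a ++ [b] ∈ S) :
    emptyOrStarLetter a b ∈ EC F := by
  have hover : ∀ n, List.replicate n a ++ [b] ∈ wordsOver {a, b} := fun n =>
    append_mem_wordsOver.2 ⟨replicate_mem_wordsOver (by simp) n,
      cons_mem_wordsOver.2 ⟨by simp, nil_mem_wordsOver _⟩⟩
  refine mem_EC_of_closed {a, b} (by simp) ?_ {(S, {([a], [])})} (by simp)
      ?_ ?_ ?_ ?_ {[], [b]} (by simp) ?_ ?_ ?_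
  · rintro w (rfl | ⟨n, rfl⟩)
    exacts [nil_mem_wordsOver _, hover n]
  · rintro _ rfl
    exact ⟨{a, b}, by simp, subset_rfl, hF⟩
  · rintro _ rfl
    exact Set.finite_singleton _
  · rintro _ rfl _ rfl
    exact ⟨cons_mem_wordsOver.2 ⟨by simp, nil_mem_wordsOver _⟩, nil_mem_wordsOver _⟩
  · rintro _ rfl _ rfl
    simp
  · rintro w (rfl | rfl)
    exacts [Or.inl rfl, Or.inr ⟨0, rfl⟩]
  · rintro _ rfl x hx hxL _ rfl
    rcases hxL with rfl | ⟨n, rfl⟩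
    · exact absurd hx h0
    · exact Or.inr ⟨n + 1, by simp [List.replicate_succ]⟩
  · rintro w (rfl | ⟨n, rfl⟩)
    · exact Or.inl (Or.inl rfl)
    · cases n with
      | zero => exact Or.inl (Or.inr rfl)
      | succ n => exact Or.inr ⟨_, rfl, _, hS n, Or.inr ⟨n, rfl⟩, _, rfl,
          by simp [List.replicate_succ]⟩

theorem emptyOrStarLetter_mem_EC_COMB [DecidableEq α] (a b : α) :
    emptyOrStarLetter a b ∈ EC COMB := by
  refine emptyOrStarLetter_mem_EC (S := wordsOver {a, b} * letterWords {b})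
    ⟨(regularOver_wordsOver _).mul (regularOver_letterWords (by simp)), {b}, by simp, rfl⟩ ?_ ?_
  · rintro ⟨x, -, y, ⟨c, -, rfl⟩, h⟩
    simp at h
  · exact fun n => ⟨_, replicate_mem_wordsOver (by simp) n, [b], ⟨b, by simp, rfl⟩, rfl⟩

theorem emptyOrStarLetter_mem_EC_NIL [DecidableEq α] (a b : α) :
    emptyOrStarLetter a b ∈ EC NIL := by
  refine emptyOrStarLetter_mem_EC (nil_longWords {a, b} 1) ?_ ?_
  · rintro ⟨-, h⟩
    simp at h
  · exact fun n => ⟨append_mem_wordsOver.2 ⟨replicate_mem_wordsOver (by simp) n,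
      cons_mem_wordsOver.2 ⟨by simp, nil_mem_wordsOver _⟩⟩, by simp⟩

/-- If all nonempty selection languages contain the empty word, then a context that leads from one
word of `a^* b` to another also applies to the empty word. -/
theorem emptyOrStarLetter_notMem_EC {F : Family α} (hF : ∀ U S, F U S → ∀ x ∈ S, [] ∈ S) {a b : α}
    (hab : a ≠ b) : emptyOrStarLetter a b ∉ EC F := by
  classical
  intro h
  obtain ⟨𝒟, N, -, h𝒟, hlong⟩ := exists_contexts_of_mem_EC h
  obtain ⟨⟨S, u, v⟩, hd, x, hx, hxL, heq⟩ := hlong (List.replicate N a ++ [b]) (Or.inr ⟨N, rfl⟩)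
    (by simp)
  obtain ⟨⟨U, hU⟩, hne, hlen, hcl⟩ := h𝒟 _ hd
  simp only at hU hne hlen heq hx hcl
  have h1 := hcl [] (hF U S hU x hx) (Or.inl rfl)
  rw [List.append_nil] at h1
  obtain ⟨m, hm⟩ := h1.resolve_left hne
  have c1 := congrArg (List.count b) heq
  have c2 := congrArg (List.count b) hm
  have l1 := congrArg List.length heq
  rcases hxL with rfl | ⟨n, rfl⟩
  · simp at l1 hlen
    omega
  · simp [List.count_replicate, hab] at c1 c2
    omega

theorem not_EC_subset_of_nil_mem [Infinite α] {F : Family α}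
    (hF : ∀ U S, F U S → ∀ x ∈ S, [] ∈ S) :
    ¬ EC (COMB (α := α)) ⊆ EC F ∧ ¬ EC (NIL (α := α)) ⊆ EC F := by
  classical
  obtain ⟨a, b, -, hab, -⟩ := exists_ne_letters α
  exact ⟨fun h => emptyOrStarLetter_notMem_EC hF hab (h (emptyOrStarLetter_mem_EC_COMB a b)),
    fun h => emptyOrStarLetter_notMem_EC hF hab (h (emptyOrStarLetter_mem_EC_NIL a b))⟩

theorem SUF.nil_mem (U : Finset α) (S : Language α) (h : SUF U S) (x : List α) (hx : x ∈ S) :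
    [] ∈ S :=
  h.2 x (h.1.2 hx) [] (nil_mem_wordsOver U) (by simpa using hx)

theorem PRE.nil_mem (U : Finset α) (S : Language α) (h : PRE U S) (x : List α) (hx : x ∈ S) :
    [] ∈ S :=
  h.2 [] (nil_mem_wordsOver U) x (h.1.2 hx) (by simpa using hx)

theorem STAR.nil_mem (U : Finset α) (S : Language α) (h : STAR U S) (x : List α) (_ : x ∈ S) :
    [] ∈ S := by
  obtain ⟨-, H, -, rfl⟩ := h
  exact Language.nil_mem_kstar H

/-- The language `a^* b ∪ b a^*`. -/
def starLetterOrReverse (a b : α) : Language α :=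
  {w | ∃ n, w = List.replicate n a ++ [b] ∨ w = b :: List.replicate n a}

theorem starLetterOrReverse_mem_EC_COMB {a b : α} (hab : a ≠ b) :
    starLetterOrReverse a b ∈ EC COMB := by
  classical
  have hcomb : ∀ c ∈ ({a, b} : Finset α), COMB {a, b} (wordsOver {a, b} * letterWords {c}) :=
    fun c hc => ⟨(regularOver_wordsOver _).mul (regularOver_letterWords (by simpa using hc)), {c},
      by simpa using hc, rfl⟩
  have hrep : ∀ n, List.replicate n a ∈ wordsOver {a, b} := replicate_mem_wordsOver (by simp)
  have hlet : ∀ c ∈ ({a, b} : Finset α), [c] ∈ wordsOver {a, b} := fun c hc =>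
    cons_mem_wordsOver.2 ⟨hc, nil_mem_wordsOver _⟩
  refine mem_EC_of_closed {a, b} (by simp) ?_
    {(wordsOver {a, b} * letterWords {b}, {([a], [])}),
      (wordsOver {a, b} * letterWords {a}, {([], [a])})} (by simp) ?_ ?_ ?_ ?_
    {[b], [b, a]} (by simp) ?_ ?_ ?_
  · rintro w ⟨n, rfl | rfl⟩
    · exact append_mem_wordsOver.2 ⟨hrep n, hlet b (by simp)⟩
    · exact cons_mem_wordsOver.2 ⟨by simp, hrep n⟩
  · rintro _ (rfl | rfl)
    exacts [⟨{a, b}, by simp, subset_rfl, hcomb b (by simp)⟩,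
      ⟨{a, b}, by simp, subset_rfl, hcomb a (by simp)⟩]
  · rintro _ (rfl | rfl) <;> exact Set.finite_singleton _
  · rintro _ (rfl | rfl) _ rfl
    exacts [⟨hlet a (by simp), nil_mem_wordsOver _⟩, ⟨nil_mem_wordsOver _, hlet a (by simp)⟩]
  · rintro _ (rfl | rfl) _ rfl <;> simp
  · rintro w (rfl | rfl)
    exacts [⟨0, Or.inl rfl⟩, ⟨1, Or.inr rfl⟩]
  · rintro _ (rfl | rfl) x hx ⟨n, hn⟩ _ rfl
    · obtain ⟨y, -, _, ⟨c, hc, rfl⟩, rfl⟩ := hx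
      obtain rfl : c = b := by simpa using hc
      rcases hn with hn | hn
      · exact ⟨n + 1, Or.inl (by rw [hn]; simp [List.replicate_succ])⟩
      · have hn' : y ++ [c] = c :: List.replicate n a := hn
        rcases n with _ | n
        · exact ⟨1, Or.inl (by rw [hn]; rfl)⟩
        · rw [List.replicate_succ', ← List.cons_append] at hn'
          have : c = a := by simpa using (List.append_inj' hn' rfl).2
          exact absurd this.symm hab
    · obtain ⟨y, -, _, ⟨c, hc, rfl⟩, rfl⟩ := hx
      obtain rfl : c = a := by simpa using hc
      rcases hn with hn | hn
      · have : c = b := by simpa using (List.append_inj' hn rfl).2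
        exact absurd this hab
      · exact ⟨n + 1, Or.inr (by rw [hn]; simp [List.replicate_succ'])⟩
  · rintro w ⟨n, rfl | rfl⟩
    · rcases n with _ | n
      · exact Or.inl (Or.inl rfl)
      · exact Or.inr ⟨_, Or.inl rfl, _, ⟨_, hrep n, [b], ⟨b, by simp, rfl⟩, rfl⟩, ⟨n, Or.inl rfl⟩,
          _, rfl, by simp [List.replicate_succ]⟩
    · rcases n with _ | _ | n
      · exact Or.inl (Or.inl rfl)
      · exact Or.inl (Or.inr rfl)
      · refine Or.inr ⟨_, Or.inr rfl, b :: List.replicate (n + 1) a,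
          ⟨b :: List.replicate n a, cons_mem_wordsOver.2 ⟨by simp, hrep n⟩, [a], ⟨a, by simp, rfl⟩,
            by simp [List.replicate_succ']⟩, ⟨n + 1, Or.inr rfl⟩, _, rfl, ?_⟩
        simp [List.replicate_succ']

/-- A context that prolongs `a^n b` to the left also applies to the circular shift `b a^n`. -/
theorem starLetterOrReverse_notMem_EC_CIRC {a b : α} (hab : a ≠ b) :
    starLetterOrReverse a b ∉ EC CIRC := by
  classical
  intro h
  obtain ⟨𝒟, N, -, h𝒟, hlong⟩ := exists_contexts_of_mem_EC h
  obtain ⟨⟨S, u, v⟩, hd, x, hx, hxL, heq⟩ := hlong (List.replicate (N + 1) a ++ [b])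
    ⟨_, Or.inl rfl⟩ (by simp)
  obtain ⟨⟨U, hU⟩, hne, hlen, hcl⟩ := h𝒟 _ hd
  simp only at hU hne hlen heq hx hcl
  have c1 := congrArg (List.count b) heq
  have hxb : x.count b = 1 := by
    obtain ⟨n, rfl | rfl⟩ := hxL <;> simp [List.count_replicate, hab]
  simp [List.count_replicate, hab, hxb] at c1
  have hv : v = [] := by
    rcases List.eq_nil_or_concat' v with rfl | ⟨v, e, rfl⟩
    · rfl
    · rw [← List.append_assoc] at heq
      obtain rfl : b = e := by simpa using (List.append_inj' heq rfl).2
      simp at c1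
      omega
  subst hv
  rw [List.append_nil] at heq hne hlen
  obtain ⟨n, rfl⟩ : ∃ n, x = List.replicate n a ++ [b] := by
    obtain ⟨n, rfl | rfl⟩ := hxL
    · exact ⟨n, rfl⟩
    · rcases n with _ | n
      · exact ⟨0, rfl⟩
      · have heq' : List.replicate (N + 1) a ++ [b] = (u ++ b :: List.replicate n a) ++ [a] := by
          rw [heq]
          simp [List.replicate_succ']
        have : b = a := by simpa using (List.append_inj' heq' rfl).2
        exact absurd this.symm hab
  have l1 := congrArg List.length heq
  simp at l1
  obtain ⟨n, rfl⟩ : ∃ m, n = m + 1 := ⟨n - 1, by omega⟩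
  obtain ⟨e, u, rfl⟩ := List.exists_cons_of_ne_nil hne
  obtain rfl : a = e := by
    simp only [List.replicate_succ, List.cons_append, List.cons.injEq] at heq
    exact heq.1
  obtain ⟨m, hm | hm⟩ := hcl (b :: List.replicate (n + 1) a) (by simpa using hU.2 _ _ hx)
    ⟨_, Or.inr rfl⟩
  · rw [List.append_nil, List.replicate_succ', ← List.cons_append, ← List.append_assoc] at hm
    have : a = b := by simpa using (List.append_inj' hm rfl).2
    exact hab this
  · simp only [List.cons_append, List.cons.injEq] at hm
    exact hab hm.1

theorem not_EC_COMB_subset_CIRC [Infinite α] : ¬ EC (COMB (α := α)) ⊆ EC CIRC := by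
  obtain ⟨a, b, -, hab, -⟩ := exists_ne_letters α
  exact fun h => starLetterOrReverse_notMem_EC_CIRC hab (h (starLetterOrReverse_mem_EC_COMB hab))

/-- The language `{b} ∪ a^* b b`. -/
def letterOrStarSquare (a b : α) : Language α :=
  {w | w = [b] ∨ ∃ n, w = List.replicate n a ++ [b, b]}

theorem letterOrStarSquare_mem_EC_NIL (a b : α) : letterOrStarSquare a b ∈ EC NIL := by
  classical
  have hb : ∀ n, List.replicate n a ++ [b, b] ∈ longWords {a, b} 2 := fun n =>
    ⟨append_mem_wordsOver.2 ⟨replicate_mem_wordsOver (by simp) n, cons_mem_wordsOver.2 ⟨by simp,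
      cons_mem_wordsOver.2 ⟨by simp, nil_mem_wordsOver _⟩⟩⟩, by simp⟩
  refine mem_EC_of_closed {a, b} (by simp) ?_ {(longWords {a, b} 2, {([a], [])})} (by simp)
      ?_ ?_ ?_ ?_ {[b], [b, b]} (by simp) ?_ ?_ ?_
  · rintro w (rfl | ⟨n, rfl⟩)
    exacts [cons_mem_wordsOver.2 ⟨by simp, nil_mem_wordsOver _⟩, (hb n).1]
  · rintro _ rfl
    exact ⟨{a, b}, by simp, subset_rfl, nil_longWords _ _⟩
  · rintro _ rfl
    exact Set.finite_singleton _
  · rintro _ rfl _ rfl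
    exact ⟨cons_mem_wordsOver.2 ⟨by simp, nil_mem_wordsOver _⟩, nil_mem_wordsOver _⟩
  · rintro _ rfl _ rfl
    simp
  · rintro w (rfl | rfl)
    exacts [Or.inl rfl, Or.inr ⟨0, rfl⟩]
  · rintro _ rfl x hx hxL _ rfl
    rcases hxL with rfl | ⟨n, rfl⟩
    · exact absurd hx.2 (by simp)
    · exact Or.inr ⟨n + 1, by simp [List.replicate_succ]⟩
  · rintro w (rfl | ⟨n, rfl⟩)
    · exact Or.inl (Or.inl rfl)
    · cases n with
      | zero => exact Or.inl (Or.inr rfl)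
      | succ n => exact Or.inr ⟨_, rfl, _, hb n, Or.inr ⟨n, rfl⟩, _, rfl,
          by simp [List.replicate_succ]⟩

theorem letterOrStarSquare_notMem_EC_COMB {a b : α} (hab : a ≠ b) :
    letterOrStarSquare a b ∉ EC COMB := by
  classical
  intro h
  obtain ⟨𝒟, N, -, h𝒟, hlong⟩ := exists_contexts_of_mem_EC h
  obtain ⟨⟨S, u, v⟩, hd, x, hx, hxL, heq⟩ := hlong (List.replicate N a ++ [b, b]) (Or.inr ⟨N, rfl⟩)
    (by simp)
  obtain ⟨⟨U, -, X, -, rfl⟩, hne, hlen, hcl⟩ := h𝒟 _ hd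
  simp only at hne hlen heq hx hcl
  have c1 := congrArg (List.count b) heq
  have l1 := congrArg List.length heq
  rcases hxL with rfl | ⟨n, rfl⟩
  · simp at l1 hlen
    omega
  · -- the selected word ends in `b`, so `b` itself is selected
    obtain ⟨y, -, _, ⟨e, he, rfl⟩, hye⟩ := hx
    replace hye : y ++ [e] = List.replicate n a ++ [b] ++ [b] := by simpa using hye
    obtain rfl : e = b := by simpa using (List.append_inj' hye rfl).2
    have hb := hcl [e] ⟨[], nil_mem_wordsOver U, [e], ⟨e, he, rfl⟩, rfl⟩ (Or.inl rfl)
    rcases hb with hb | ⟨m, hm⟩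
    · have := congrArg List.length hb
      have := List.length_pos_iff.2 hne
      simp at *
      omega
    · have := congrArg (List.count e) hm
      simp [List.count_replicate, hab] at c1 this
      omega

theorem not_EC_NIL_subset_COMB [Infinite α] : ¬ EC (NIL (α := α)) ⊆ EC COMB := by
  obtain ⟨a, b, -, hab, -⟩ := exists_ne_letters α
  exact fun h => letterOrStarSquare_notMem_EC_COMB hab (h (letterOrStarSquare_mem_EC_NIL a b))

section

open Filter
open scoped List

/-! ### The language `a^* b^*` -/

theorem mem_of_append_eq_replicate {a : α} {u p : List α} {n : ℕ}
    (h : List.replicate n a = u ++ p) (hp : p ≠ []) : a ∈ p := by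
  obtain ⟨c, p, rfl⟩ := List.exists_cons_of_ne_nil hp
  have : c ∈ List.replicate n a := h ▸ by simp
  obtain rfl := List.eq_of_mem_replicate this
  simp

/-- The language `a^* b^*`: the words over `{a, b}` in which no `a` follows a `b`. -/
def sortedWords [DecidableEq α] (a b : α) : Language α :=
  {w | w ∈ wordsOver {a, b} ∧ ¬ [b, a] <+ w}

/-- The automaton of `a^* b^*`; its states are ordered by the progress of a run: `0` before the
first `b`, `1` afterwards, and `2` after an `a` following a `b`. -/
def sortedWordsDFA [DecidableEq α] (a : α) : DFA α (Fin 3) where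
  step z c := if c = a then (if z = 0 then 0 else 2) else (if z = 2 then 2 else 1)
  start := 0
  accept := {z | z ≠ 2}

theorem sortedWords_eq [DecidableEq α] {a b : α} (hab : a ≠ b) :
    sortedWords a b = (sortedWordsDFA a).accepts ⊓ wordsOver {a, b} := by
  have h2 : ∀ w : List α, (sortedWordsDFA a).evalFrom 2 w = 2 := by
    intro w
    induction w with
    | nil => rfl
    | cons c w ih =>
      rw [DFA.evalFrom_cons, show (sortedWordsDFA a).step 2 c = 2 by simp [sortedWordsDFA], ih]
  have h1 : ∀ w ∈ wordsOver {a, b}, (sortedWordsDFA a).evalFrom 1 w = 2 ↔ a ∈ w := by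
    intro w
    induction w with
    | nil => simp
    | cons c w ih =>
      intro hw
      rw [cons_mem_wordsOver] at hw
      rw [DFA.evalFrom_cons]
      by_cases hc : c = a
      · rw [show (sortedWordsDFA a).step 1 c = 2 by simp [sortedWordsDFA, hc], h2]
        simp [hc]
      · rw [show (sortedWordsDFA a).step 1 c = 1 by simp [sortedWordsDFA, hc], ih hw.2]
        simp [Ne.symm hc]
  have h0 : ∀ w ∈ wordsOver {a, b}, (sortedWordsDFA a).evalFrom 0 w = 2 ↔ [b, a] <+ w := by
    intro w
    induction w with
    | nil => simp
    | cons c w ih =>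
      intro hw
      rw [cons_mem_wordsOver] at hw
      rw [DFA.evalFrom_cons]
      by_cases hc : c = a
      · rw [show (sortedWordsDFA a).step 0 c = 0 by simp [sortedWordsDFA, hc], ih hw.2,
          List.sublist_cons_iff]
        simp [hc, hab.symm]
      · obtain rfl : c = b := by simpa [hc] using hw.1
        rw [show (sortedWordsDFA a).step 0 c = 1 by simp [sortedWordsDFA, hc], h1 w hw.2,
          List.cons_sublist_cons, List.singleton_sublist]
  ext w
  constructor
  · exact fun ⟨hw, h⟩ => ⟨fun h' => h ((h0 w hw).1 h'), hw⟩
  · exact fun ⟨h, hw⟩ => ⟨hw, fun h' => h ((h0 w hw).2 h')⟩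

theorem regularOver_sortedWords [DecidableEq α] {a b : α} (hab : a ≠ b) :
    RegularOver {a, b} (sortedWords a b) := by
  rw [sortedWords_eq hab]
  exact ⟨Language.IsRegular.inf ⟨_, inferInstance, _, rfl⟩ (isRegular_wordsOver _), inf_le_right⟩

theorem ord_sortedWords [DecidableEq α] {a b : α} (hab : a ≠ b) :
    ORD {a, b} (sortedWords a b) := by
  refine ⟨regularOver_sortedWords hab, Fin 3, inferInstance, inferInstance,
    (sortedWordsDFA a).comap Subtype.val, fun c => ?_, fun w => ?_⟩
  · change Monotone fun z => (sortedWordsDFA a).step z c.1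
    by_cases hc : c.1 = a <;> simp only [sortedWordsDFA, hc, if_true, if_false] <;>
      intro x y hxy <;> revert x y <;> decide
  · rw [DFA.accepts_comap, sortedWords_eq hab]
    refine ⟨fun h => ⟨h, fun c hc => ?_⟩, fun h => h.1⟩
    obtain ⟨c, -, rfl⟩ := List.mem_map.1 hc
    exact c.2

theorem inf_sortedWords [DecidableEq α] {a b : α} (hab : a ≠ b) :
    INF {a, b} (sortedWords a b) :=
  ⟨regularOver_sortedWords hab, fun _ _ y hy _ _ h => ⟨hy, fun hs => h.2 <|
    hs.trans ((List.sublist_append_right _ y).trans (List.sublist_append_left _ _))⟩⟩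

/-- A covering of `a^* b^*` has a selected word `p s` with `a` in `p` and `b` in `s`; no other
selected word over `{a, b}` contains an `a` after a `b`. -/
theorem exists_selected_of_covered_sortedWords [DecidableEq α] {F : Family α} {a b : α}
    (hab : a ≠ b) (h : FinitelyCovered F {a, b} (sortedWords a b)) :
    ∃ U S p s, F U S ∧ p ++ s ∈ S ∧ a ∈ p ∧ b ∈ s ∧ p ++ s ∈ wordsOver {a, b} ∧
      ∀ y ∈ S, y ∈ wordsOver {a, b} → ¬ [b, a] <+ y := by
  obtain ⟨𝒮, N, -, h𝒮, hmid⟩ := h.exists_middle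
  have hmem : List.replicate (N + 1) a ++ [] ++ List.replicate (N + 1) b ∈ sortedWords a b := by
    refine ⟨append_mem_wordsOver.2 ⟨append_mem_wordsOver.2 ⟨replicate_mem_wordsOver (by simp) _,
      nil_mem_wordsOver _⟩, replicate_mem_wordsOver (by simp) _⟩, fun hs => ?_⟩
    rw [List.append_nil] at hs
    obtain ⟨l, r, heq, hl, hr⟩ := List.sublist_append_iff.1 hs
    rcases l with _ | ⟨c, l⟩
    · obtain rfl : [b, a] = r := heq
      exact hab (List.eq_of_mem_replicate (hr.subset (by simp)))
    · simp only [List.cons_append, List.cons.injEq] at heq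
      obtain ⟨rfl, -⟩ := heq
      exact hab (List.eq_of_mem_replicate (hl.subset (by simp))).symm
  obtain ⟨S, hS, u, p, s, v, hp, hs, hpne, hsne, hx, hcl⟩ := hmid _ _ _ (by simp) (by simp) hmem
  obtain ⟨U, hU⟩ := h𝒮 S hS
  rw [List.append_nil] at hx
  have hb : b ∈ s := by
    have := congrArg List.reverse hs
    rw [List.reverse_replicate, List.reverse_append] at this
    simpa using mem_of_append_eq_replicate this (by simpa using hsne)
  have hov := hmem.1
  rw [hp, hs, List.append_nil] at hov
  simp only [append_mem_wordsOver] at hov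
  refine ⟨U, S, p, s, hU, hx, mem_of_append_eq_replicate hp hpne, hb,
    append_mem_wordsOver.2 ⟨hov.1.2, hov.2.1⟩, fun y hy hyA hs => (hcl y hy hyA).2 ?_⟩
  exact hs.trans ((List.sublist_append_right u y).trans (List.sublist_append_left _ v))

/-- A language `E U^* H` with a word in which `a` and `b` occur has a word with the factor `b a`. -/
theorem not_covered_SYDEF_sortedWords [DecidableEq α] {a b : α} (hab : a ≠ b) :
    ¬ FinitelyCovered SYDEF {a, b} (sortedWords a b) := by
  intro h
  obtain ⟨U, S, p, s, hF, hx, ha, hb, hov, hS⟩ := exists_selected_of_covered_sortedWords hab h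
  obtain ⟨hreg, E, H, hE, hH, rfl⟩ := hF
  have hU := hreg.mem_wordsOver hx
  obtain ⟨_, ⟨e, he, w, hw, rfl⟩, g, hg, heq⟩ := hx
  replace heq : e ++ w ++ g = p ++ s := heq
  have hov' := hov
  rw [← heq] at hov'
  simp only [append_mem_wordsOver] at hov'
  have hba : ∀ V : Finset α, a ∈ V → b ∈ V → [b, a] ∈ wordsOver V := fun V h1 h2 =>
    cons_mem_wordsOver.2 ⟨h2, cons_mem_wordsOver.2 ⟨h1, nil_mem_wordsOver V⟩⟩
  refine hS (e ++ (w ++ [b, a]) ++ g) ⟨_, ⟨e, he, _, append_mem_wordsOver.2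
    ⟨hw, hba U (hU a (by simp [ha])) (hU b (by simp [hb]))⟩, rfl⟩, g, hg, rfl⟩ ?_ ?_
  · exact append_mem_wordsOver.2 ⟨append_mem_wordsOver.2 ⟨hov'.1.1,
      append_mem_wordsOver.2 ⟨hov'.1.2, hba _ (by simp) (by simp)⟩⟩, hov'.2⟩
  · exact ((List.sublist_append_right w _).trans (List.sublist_append_right e _)).trans
      (List.sublist_append_left _ g)

theorem cons_sublist_append_of_mem {a b : α} {s p : List α} (hb : b ∈ s) (ha : a ∈ p) :
    [b, a] <+ s ++ p :=
  (List.singleton_sublist.2 hb).append (List.singleton_sublist.2 ha)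

theorem not_covered_CIRC_sortedWords [DecidableEq α] {a b : α} (hab : a ≠ b) :
    ¬ FinitelyCovered CIRC {a, b} (sortedWords a b) := by
  intro h
  obtain ⟨U, S, p, s, hF, hx, ha, hb, hov, hS⟩ := exists_selected_of_covered_sortedWords hab h
  rw [append_mem_wordsOver] at hov
  exact hS _ (hF.2 p s hx) (append_mem_wordsOver.2 hov.symm) (cons_sublist_append_of_mem hb ha)

theorem not_covered_STAR_sortedWords [DecidableEq α] {a b : α} (hab : a ≠ b) :
    ¬ FinitelyCovered STAR {a, b} (sortedWords a b) := by
  intro h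
  obtain ⟨U, S, p, s, ⟨-, H, -, rfl⟩, hx, ha, hb, hov, hS⟩ :=
    exists_selected_of_covered_sortedWords hab h
  refine hS ((p ++ s) ++ (p ++ s)) ?_ (append_mem_wordsOver.2 ⟨hov, hov⟩)
    (cons_sublist_append_of_mem (by simp [hb]) (by simp [ha]))
  have : H∗ * H∗ = H∗ := kstar_mul_kstar H
  exact this ▸ Language.append_mem_mul hx hx

/-! ### Languages that count modulo two -/

/-- In a non-counting language, sufficiently long powers of a letter may be prolonged. -/
theorem NC.eventually {U : Finset α} {S : Language α} (h : NC U S) (a : α) :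
    ∀ᶠ n in atTop, ∀ p s, p ++ List.replicate n a ++ s ∈ S →
      p ++ List.replicate (n + 1) a ++ s ∈ S := by
  obtain ⟨hS, k, -, hk⟩ := h
  filter_upwards [eventually_ge_atTop (k + 1)] with n hn p s hx
  have hU := hS.mem_wordsOver hx
  simp only [append_mem_wordsOver] at hU
  have ha : a ∈ U := hU.1.2 a (by simp; omega)
  have := (hk (p ++ List.replicate (n - k) a)
    (append_mem_wordsOver.2 ⟨hU.1.1, replicate_mem_wordsOver ha _⟩) [a]
    (cons_mem_wordsOver.2 ⟨ha, nil_mem_wordsOver _⟩) s hU.2).1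
  simp only [wordPow_singleton, List.append_assoc p, List.replicate_append_replicate] at this
  rw [Nat.sub_add_cancel (by omega), show n - k + (k + 1) = n + 1 by omega] at this
  simpa using this (by simpa using hx)

theorem PS.eventually {U : Finset α} {S : Language α} (h : PS U S) (a : α) :
    ∀ᶠ n in atTop, List.replicate n a ∈ S → List.replicate (n + 1) a ∈ S := by
  obtain ⟨hS, k, hk, h⟩ := h
  filter_upwards [eventually_ge_atTop k] with n hn hx
  have ha : a ∈ U := hS.mem_wordsOver hx a (by simp; omega)
  simp only [← wordPow_singleton] at hx ⊢
  rcases h [a] (cons_mem_wordsOver.2 ⟨ha, nil_mem_wordsOver _⟩) with h | h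
  · exact absurd hx (h n hn)
  · exact h _ (by omega)

/-- A language in which, within arbitrarily long prefixes and suffixes, arbitrarily long powers of a
letter cannot be prolonged is not covered by non-counting languages. -/
theorem not_covered_NC {A : Finset α} {T : Language α} (hT : T ≤ wordsOver A) {a : α} (ha : a ∈ A)
    (h : ∀ N, ∃ p s, N < p.length ∧ N < s.length ∧
      ∃ n ≥ N, p ++ List.replicate n a ++ s ∈ T ∧ p ++ List.replicate (n + 1) a ++ s ∉ T) :
    ¬ FinitelyCovered NC A T := by
  intro hcov
  obtain ⟨𝒮, N, hfin, h𝒮, hmid⟩ := hcov.exists_middle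
  obtain ⟨M, hM⟩ := eventually_atTop.1 <| (eventually_all_finite hfin).2 fun S hS =>
    (h𝒮 S hS).elim fun U hU => NC.eventually hU a
  obtain ⟨p, s, hp, hs, n, hn, hmem, hnot⟩ := h (max N M)
  obtain ⟨S, hS, u, p', s', v, rfl, rfl, -, -, hx, hcl⟩ := hmid p _ s (by omega) (by omega) hmem
  have hov : _ ∈ wordsOver A := hT hmem
  simp only [append_mem_wordsOver] at hov
  refine hnot ?_
  have := hcl _ (hM n (by omega) S hS p' s' hx) (append_mem_wordsOver.2
    ⟨append_mem_wordsOver.2 ⟨hov.1.1.2, replicate_mem_wordsOver ha _⟩, hov.2.1⟩)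
  simpa using this

/-- The language `(aa)^*`. -/
def evenPowers (a : α) : Language α := ({[a, a]} : Language α)∗

theorem mem_evenPowers {a : α} {w : List α} :
    w ∈ evenPowers a ↔ ∃ n, w = List.replicate (2 * n) a := by
  have : ∀ n, wordPow [a, a] n = List.replicate (2 * n) a := by
    intro n
    induction n with
    | zero => rfl
    | succ n ih => rw [wordPow_succ, ih, Nat.mul_succ]; rfl
  simp only [evenPowers, mem_kstar_singleton, this]

theorem regularOver_evenPowers {U : Finset α} {a : α} (ha : a ∈ U) :
    RegularOver U (evenPowers a) :=
  (regularOver_singleton (cons_mem_wordsOver.2 ⟨ha, cons_mem_wordsOver.2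
    ⟨ha, nil_mem_wordsOver U⟩⟩)).kstar

theorem star_evenPowers (a : α) : STAR {a} (evenPowers a) :=
  ⟨regularOver_evenPowers (by simp), {[a, a]}, regularOver_singleton (cons_mem_wordsOver.2
    ⟨by simp, cons_mem_wordsOver.2 ⟨by simp, nil_mem_wordsOver _⟩⟩), rfl⟩

theorem comm_evenPowers (a : α) : COMM {a} (evenPowers a) := by
  refine ⟨regularOver_evenPowers (by simp), fun w hw w' hp => ?_⟩
  obtain ⟨n, rfl⟩ := mem_evenPowers.1 hw
  rw [List.perm_replicate.1 hp.symm]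
  exact hw

theorem not_covered_PS_evenPowers (a : α) : ¬ FinitelyCovered PS {a} (evenPowers a) := by
  intro hcov
  obtain ⟨𝒮, N, hfin, h𝒮, hmid⟩ := hcov.exists_middle
  obtain ⟨M, hM⟩ := eventually_atTop.1 <| (eventually_all_finite hfin).2 fun S hS =>
    (h𝒮 S hS).elim fun U hU => PS.eventually hU a
  have hmem : List.replicate (N + 1) a ++ List.replicate (2 * M) a ++ List.replicate (N + 1) a ∈
      evenPowers a := mem_evenPowers.2 ⟨N + 1 + M, by
    simp only [List.replicate_append_replicate]; congr 1; omega⟩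
  obtain ⟨S, hS, u, p', s', v, hp, hs, -, -, hx, hcl⟩ := hmid _ _ _ (by simp) (by simp) hmem
  obtain ⟨-, -, hp'⟩ := List.append_eq_replicate_iff.1 hp.symm
  obtain ⟨-, hs', -⟩ := List.append_eq_replicate_iff.1 hs.symm
  have lp := congrArg List.length hp
  have ls := congrArg List.length hs
  rw [hp', hs', List.replicate_append_replicate, List.replicate_append_replicate] at hx
  have := hcl _ (hM _ (by omega) S hS hx) (replicate_mem_wordsOver (by simp) _)
  obtain ⟨n, hn⟩ := mem_evenPowers.1 this
  have := congrArg List.length hn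
  simp at this lp ls
  omega

theorem replicate_append_cons_inj {a b : α} (hab : a ≠ b) {i j : ℕ} {r r' : List α}
    (h : List.replicate i a ++ b :: r = List.replicate j a ++ b :: r') : i = j ∧ r = r' := by
  induction i generalizing j with
  | zero =>
    cases j with
    | zero => simpa using h
    | succ j =>
      simp only [List.replicate_zero, List.nil_append, List.replicate_succ, List.cons_append,
        List.cons.injEq] at h
      exact absurd h.1.symm hab
  | succ i ih =>
    cases j with
    | zero =>
      simp only [List.replicate_zero, List.nil_append, List.replicate_succ, List.cons_append,
        List.cons.injEq] at h
      exact absurd h.1 hab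
    | succ j =>
      simp only [List.replicate_succ, List.cons_append, List.cons.injEq, true_and] at h
      exact ⟨congrArg _ (ih h).1, (ih h).2⟩

/-- The language `(aa)^* b {a, b}^*`. -/
def evenPrefix [DecidableEq α] (a b : α) : Language α :=
  evenPowers a * {[b]} * wordsOver {a, b}

theorem sydef_evenPrefix [DecidableEq α] (a b : α) : SYDEF {a, b} (evenPrefix a b) := by
  have hE : RegularOver {a, b} (evenPowers a * {[b]}) := (regularOver_evenPowers (by simp)).mul
    (regularOver_singleton (cons_mem_wordsOver.2 ⟨by simp, nil_mem_wordsOver _⟩))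
  exact ⟨hE.mul (regularOver_wordsOver _), _, 1, hE, regularOver_one _, (mul_one _).symm⟩

theorem mem_evenPrefix [DecidableEq α] {a b : α} {w : List α} :
    w ∈ evenPrefix a b ↔ ∃ n, ∃ r ∈ wordsOver {a, b}, w = List.replicate (2 * n) a ++ b :: r := by
  constructor
  · rintro ⟨_, ⟨e, he, _, rfl, rfl⟩, r, hr, rfl⟩
    obtain ⟨n, rfl⟩ := mem_evenPowers.1 he
    exact ⟨n, r, hr, by simp⟩
  · rintro ⟨n, r, hr, rfl⟩
    exact ⟨_, ⟨_, mem_evenPowers.2 ⟨n, rfl⟩, [b], rfl, rfl⟩, r, hr, by simp⟩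

theorem not_covered_NC_evenPrefix [DecidableEq α] {a b : α} (hab : a ≠ b) :
    ¬ FinitelyCovered NC {a, b} (evenPrefix a b) := by
  refine not_covered_NC (sydef_evenPrefix a b).1.2 (a := a) (by simp) fun N =>
    ⟨List.replicate (2 * (N + 1)) a, b :: List.replicate N b, by simp; omega, by simp, 2 * N,
      by omega, ?_, ?_⟩
  · exact mem_evenPrefix.2 ⟨N + 1 + N, _, replicate_mem_wordsOver (a := b) (by simp) N, by
      rw [List.replicate_append_replicate, Nat.mul_add 2 (N + 1)]⟩
  · intro h
    obtain ⟨n, r, -, h⟩ := mem_evenPrefix.1 h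
    rw [List.replicate_append_replicate] at h
    have := (replicate_append_cons_inj hab h).1
    omega

/-- The words over `{a, b}` without a factor `b a^n b` with `n` odd. -/
def noOddBlock [DecidableEq α] (a b : α) : Language α :=
  {w | w ∈ wordsOver {a, b} ∧ ∀ n, ¬ (b :: List.replicate (2 * n + 1) a ++ [b]) <:+: w}

theorem inf_noOddBlock [DecidableEq α] (a b : α) : INF {a, b} (noOddBlock a b) := by
  refine ⟨⟨?_, fun w hw => hw.1⟩, fun x _ y hy z _ h => ⟨hy, fun n hn => h.2 n ?_⟩⟩
  · have hreg : RegularOver {a, b} (({[b, a]} : Language α) * evenPowers a * {[b]}) :=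
      ((regularOver_singleton (cons_mem_wordsOver.2 ⟨by simp, cons_mem_wordsOver.2
        ⟨by simp, nil_mem_wordsOver _⟩⟩)).mul (regularOver_evenPowers (by simp))).mul
        (regularOver_singleton (cons_mem_wordsOver.2 ⟨by simp, nil_mem_wordsOver _⟩))
    have : noOddBlock a b = wordsOver {a, b} ⊓ (wordsOver {a, b} *
        (({[b, a]} : Language α) * evenPowers a * {[b]}) * wordsOver {a, b})ᶜ := by
      ext w
      constructor
      · rintro ⟨hw, h⟩
        refine ⟨hw, ?_⟩
        rintro ⟨_, ⟨x, -, _, ⟨_, ⟨_, rfl, e, he, rfl⟩, _, rfl, rfl⟩, rfl⟩, y, -, rfl⟩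
        obtain ⟨n, rfl⟩ := mem_evenPowers.1 he
        exact h n ⟨x, y, by simp [List.replicate_succ]⟩
      · rintro ⟨hw, h⟩
        refine ⟨hw, ?_⟩
        rintro n ⟨x, y, rfl⟩
        replace hw : _ ∈ wordsOver {a, b} := hw
        rw [append_mem_wordsOver, append_mem_wordsOver] at hw
        exact h ⟨_, ⟨x, hw.1.1, _, ⟨_, ⟨_, rfl, _, mem_evenPowers.2 ⟨n, rfl⟩, rfl⟩, _, rfl, rfl⟩,
          rfl⟩, y, hw.2, by simp [List.replicate_succ]⟩
    rw [this]
    exact (isRegular_wordsOver _).inf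
      (((regularOver_wordsOver _).mul hreg).mul (regularOver_wordsOver _)).1.compl
  · exact hn.trans ⟨x, z, rfl⟩

theorem not_covered_NC_noOddBlock [DecidableEq α] {a b : α} (hab : a ≠ b) :
    ¬ FinitelyCovered NC {a, b} (noOddBlock a b) := by
  refine not_covered_NC (inf_noOddBlock a b).1.2 (a := a) (by simp) fun N =>
    ⟨List.replicate N a ++ [b], b :: List.replicate N a, by simp, by simp, 2 * N,
      by omega, ⟨?_, ?_⟩, ?_⟩
  · have h1 : ∀ n, List.replicate n a ∈ wordsOver {a, b} := replicate_mem_wordsOver (by simp)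
    exact append_mem_wordsOver.2 ⟨append_mem_wordsOver.2 ⟨append_mem_wordsOver.2 ⟨h1 N,
      cons_mem_wordsOver.2 ⟨by simp, nil_mem_wordsOver _⟩⟩, h1 _⟩,
      cons_mem_wordsOver.2 ⟨by simp, h1 N⟩⟩
  · rintro n ⟨x, y, h⟩
    -- the part to the left of the block contains no `b`
    have hc := congrArg (List.count b) h
    have hx : ∀ c ∈ x, c = a := by
      intro c hc'
      have hmem : c ∈ List.replicate N a ++ [b] ++ List.replicate (2 * N) a ++
        b :: List.replicate N a := h ▸ by simp [hc']
      have hcb : c ≠ b := by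
        rintro rfl
        have := List.count_pos_iff.2 hc'
        simp [List.count_replicate, hab] at hc
        omega
      simp only [List.mem_append, List.mem_cons, List.mem_replicate] at hmem
      grind
    obtain ⟨i, rfl⟩ : ∃ i, x = List.replicate i a := ⟨_, List.eq_replicate_of_mem hx⟩
    have h1 : List.replicate i a ++ b :: (List.replicate (2 * n + 1) a ++ b :: y) =
        List.replicate N a ++ b :: (List.replicate (2 * N) a ++ b :: List.replicate N a) := by
      simpa using h
    have := (replicate_append_cons_inj hab (replicate_append_cons_inj hab h1).2).1
    omega
  · rintro ⟨-, h⟩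
    exact h N ⟨List.replicate N a, List.replicate N a, by simp⟩

/-! ### The languages `a^* b c^* ∪ c^*` and `a^* b c^* ∪ a^*` -/

/-- The language `a^* b c^*`. -/
def sandwich (a b c : α) : Language α :=
  {w | ∃ i j, w = List.replicate i a ++ b :: List.replicate j c}

/-- The language `a^* b c^* ∪ c^*`. -/
def sandwichOrRight (a b c : α) : Language α :=
  {w | (∃ i j, w = List.replicate i a ++ b :: List.replicate j c) ∨ ∃ j, w = List.replicate j c}

/-- The language `a^* b c^* ∪ a^*`. -/
def sandwichOrLeft (a b c : α) : Language α :=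
  {w | (∃ i j, w = List.replicate i a ++ b :: List.replicate j c) ∨ ∃ i, w = List.replicate i a}

theorem regularOver_powers {U : Finset α} {a : α} (ha : a ∈ U) :
    RegularOver U ({[a]} : Language α)∗ :=
  (regularOver_singleton (cons_mem_wordsOver.2 ⟨ha, nil_mem_wordsOver U⟩)).kstar

theorem mem_powers {a : α} {w : List α} :
    w ∈ ({[a]} : Language α)∗ ↔ ∃ n, w = List.replicate n a := by
  simp only [mem_kstar_singleton, wordPow_singleton]

theorem regularOver_sandwich {U : Finset α} {a b c : α} (ha : a ∈ U) (hb : b ∈ U) (hc : c ∈ U) :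
    RegularOver U (sandwich a b c) := by
  have : sandwich a b c =
      ({[a]} : Language α)∗ * {[b]} * ({[c]} : Language α)∗ := by
    ext w
    constructor
    · rintro ⟨i, j, rfl⟩
      exact ⟨_, ⟨_, mem_powers.2 ⟨i, rfl⟩, [b], rfl, rfl⟩, _, mem_powers.2 ⟨j, rfl⟩, by simp⟩
    · rintro ⟨_, ⟨_, hx, _, rfl, rfl⟩, _, hy, rfl⟩
      obtain ⟨i, rfl⟩ := mem_powers.1 hx
      obtain ⟨j, rfl⟩ := mem_powers.1 hy
      exact ⟨i, j, by simp⟩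
  rw [this]
  exact ((regularOver_powers ha).mul (regularOver_singleton (cons_mem_wordsOver.2
    ⟨hb, nil_mem_wordsOver U⟩))).mul (regularOver_powers hc)

theorem suf_sandwichOrRight [DecidableEq α] (a b c : α) :
    SUF {a, b, c} (sandwichOrRight a b c) := by
  constructor
  · have : sandwichOrRight a b c = sandwich a b c + ({[c]} : Language α)∗ := by
      ext w
      rw [Language.mem_add, mem_powers]
      rfl
    rw [this]
    exact (regularOver_sandwich (by simp) (by simp) (by simp)).add (regularOver_powers (by simp))
  · intro x hx y hy h
    clear hx hy
    induction x with
    | nil => exact h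
    | cons d x ih =>
      refine ih ?_
      rw [List.cons_append] at h
      rcases h with ⟨i, j, h⟩ | ⟨j, h⟩
      · cases i with
        | zero =>
          simp only [List.replicate_zero, List.nil_append, List.cons.injEq] at h
          exact Or.inr ⟨j, h.2⟩
        | succ i =>
          simp only [List.replicate_succ, List.cons_append, List.cons.injEq] at h
          exact Or.inl ⟨i, j, h.2⟩
      · cases j with
        | zero => simp at h
        | succ j =>
          simp only [List.replicate_succ, List.cons.injEq] at h
          exact Or.inr ⟨j, h.2⟩

theorem pre_sandwichOrLeft [DecidableEq α] (a b c : α) :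
    PRE {a, b, c} (sandwichOrLeft a b c) := by
  constructor
  · have : sandwichOrLeft a b c = sandwich a b c + ({[a]} : Language α)∗ := by
      ext w
      rw [Language.mem_add, mem_powers]
      rfl
    rw [this]
    exact (regularOver_sandwich (by simp) (by simp) (by simp)).add (regularOver_powers (by simp))
  · intro x hx y hy h
    clear hx hy
    induction y using List.reverseRecOn with
    | nil => simpa using h
    | append_singleton y d ih =>
      refine ih ?_
      rw [← List.append_assoc] at h
      rcases h with ⟨i, j, h⟩ | ⟨i, h⟩
      · cases j with
        | zero => exact Or.inr ⟨i, (List.append_inj' h rfl).1⟩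
        | succ j =>
          rw [List.replicate_succ', ← List.cons_append, ← List.append_assoc] at h
          exact Or.inl ⟨i, j, (List.append_inj' h rfl).1⟩
      · cases i with
        | zero => simp at h
        | succ i =>
          rw [List.replicate_succ'] at h
          exact Or.inr ⟨i, (List.append_inj' h rfl).1⟩

/-- The selected word has the form `a^i b c^j`. Its prefix `a^i` would then be selected as well, and
lead to a word that contains `a` but not `b`. -/
theorem not_covered_PRE_sandwichOrRight [DecidableEq α] {a b c : α} (hab : a ≠ b) (hac : a ≠ c)
    (hbc : b ≠ c) : ¬ FinitelyCovered PRE {a, b, c} (sandwichOrRight a b c) := by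
  intro hcov
  obtain ⟨𝒮, N, -, h𝒮, hmid⟩ := hcov.exists_middle
  have hmem : List.replicate (N + 1) a ++ [b] ++ List.replicate (N + 1) c ∈
      sandwichOrRight a b c := Or.inl ⟨N + 1, N + 1, by simp⟩
  obtain ⟨S, hS, u, p', s', v, hp, hs, -, -, hx, hcl⟩ := hmid _ _ _ (by simp) (by simp) hmem
  obtain ⟨U, hU⟩ := h𝒮 S hS
  have hp'U := hU.1.mem_wordsOver hx
  rw [List.append_assoc] at hx hp'U
  rw [append_mem_wordsOver] at hp'U
  have hp' : p' ∈ wordsOver {a, b, c} := fun d hd => by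
    have : d ∈ List.replicate (N + 1) a := hp ▸ by simp [hd]
    simp [List.eq_of_mem_replicate this]
  have h := hcl p' (hU.2 p' hp'U.1 _ hp'U.2 hx) hp'
  rw [← hp] at h
  have hb : b ∉ List.replicate (N + 1) a ++ v := by
    intro hb
    rcases List.mem_append.1 hb with hb | hb
    · exact hab (List.eq_of_mem_replicate hb).symm
    · exact hbc (List.eq_of_mem_replicate (hs ▸ List.mem_append_right s' hb))
  rcases h with ⟨i, j, h⟩ | ⟨j, h⟩
  · exact hb (h ▸ by simp)
  · have : a ∈ List.replicate j c := h ▸ by simp [List.replicate_succ]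
    exact hac (List.eq_of_mem_replicate this)

/-- The selected word has the form `a^i b c^j`. Its suffix `c^j` would then be selected as well, and
lead to a word that contains `c` but not `b`. -/
theorem not_covered_SUF_sandwichOrLeft [DecidableEq α] {a b c : α} (hab : a ≠ b) (hac : a ≠ c)
    (hbc : b ≠ c) : ¬ FinitelyCovered SUF {a, b, c} (sandwichOrLeft a b c) := by
  intro hcov
  obtain ⟨𝒮, N, -, h𝒮, hmid⟩ := hcov.exists_middle
  have hmem : List.replicate (N + 1) a ++ [b] ++ List.replicate (N + 1) c ∈
      sandwichOrLeft a b c := Or.inl ⟨N + 1, N + 1, by simp⟩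
  obtain ⟨S, hS, u, p', s', v, hp, hs, -, -, hx, hcl⟩ := hmid _ _ _ (by simp) (by simp) hmem
  obtain ⟨U, hU⟩ := h𝒮 S hS
  have hs'U := hU.1.mem_wordsOver hx
  rw [append_mem_wordsOver] at hs'U
  have hs' : s' ∈ wordsOver {a, b, c} := fun d hd => by
    have : d ∈ List.replicate (N + 1) c := hs ▸ by simp [hd]
    simp [List.eq_of_mem_replicate this]
  have h := hcl s' (hU.2 _ hs'U.1 s' hs'U.2 hx) hs'
  rw [List.append_assoc, ← hs] at h
  have hb : b ∉ u ++ List.replicate (N + 1) c := by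
    intro hb
    rcases List.mem_append.1 hb with hb | hb
    · exact hab (List.eq_of_mem_replicate (hp ▸ List.mem_append_left p' hb)).symm
    · exact hbc (List.eq_of_mem_replicate hb)
  rcases h with ⟨i, j, h⟩ | ⟨i, h⟩
  · exact hb (h ▸ by simp)
  · have : c ∈ List.replicate i a := h ▸ by simp [List.replicate_succ]
    exact hac (List.eq_of_mem_replicate this).symm

/-! ### The languages `(ab)^*` and `(ab)^* ∪ (ba)^*` -/

theorem wordPow_injective_of_length {x y : List α} {m n : ℕ} (hx : x ≠ [])
    (hlen : x.length = y.length) (h : (wordPow x m).length = (wordPow y n).length) : m = n := by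
  rw [length_wordPow, length_wordPow, ← hlen] at h
  exact Nat.eq_of_mul_eq_mul_right (List.length_pos_iff.2 hx) h

/-- The language `(ab)^*`. -/
def alternating (a b : α) : Language α := ({[a, b]} : Language α)∗

theorem pair_mem_wordsOver [DecidableEq α] (a b : α) : [a, b] ∈ wordsOver {a, b} :=
  cons_mem_wordsOver.2 ⟨by simp, cons_mem_wordsOver.2 ⟨by simp, nil_mem_wordsOver _⟩⟩

theorem star_alternating [DecidableEq α] (a b : α) : STAR {a, b} (alternating a b) :=
  ⟨(regularOver_singleton (pair_mem_wordsOver a b)).kstar, _,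
    regularOver_singleton (pair_mem_wordsOver a b), rfl⟩

/-- Two circular shifts of a selected word that begin with different letters would give two words
of `(ab)^*` of equal length. -/
theorem not_covered_CIRC_alternating [DecidableEq α] {a b : α} (hab : a ≠ b) :
    ¬ FinitelyCovered CIRC {a, b} (alternating a b) := by
  intro hcov
  obtain ⟨𝒮, N, -, h𝒮, hmid⟩ := hcov.exists_middle
  have hmem : wordPow [a, b] (N + 1) ++ [a, b] ++ wordPow [a, b] (N + 1) ∈ alternating a b := by
    refine mem_kstar_singleton.2 ⟨N + 1 + 1 + (N + 1), ?_⟩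
    rw [wordPow_add _ (N + 1 + 1), wordPow_succ' _ (N + 1)]
  obtain ⟨S, hS, u, p', s', v, hp, hs, -, -, hx, hcl⟩ :=
    hmid _ _ _ (by simp; omega) (by simp; omega) hmem
  obtain ⟨U, hU⟩ := h𝒮 S hS
  have hW := wordPow_mem_wordsOver (pair_mem_wordsOver a b) (N + 1)
  have hp' : p' ∈ wordsOver {a, b} := by
    rw [hp] at hW
    exact (append_mem_wordsOver.1 hW).2
  have hs' : s' ∈ wordsOver {a, b} := by
    rw [hs] at hW
    exact (append_mem_wordsOver.1 hW).1
  have ha : a ∈ ({a, b} : Finset α) := by simp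
  have hb : b ∈ ({a, b} : Finset α) := by simp
  have h1 := hcl ([b] ++ s' ++ (p' ++ [a]))
    (by simpa using hU.2 (p' ++ [a]) ([b] ++ s') (by simpa using hx))
    (by simp only [append_mem_wordsOver, cons_mem_wordsOver]
        exact ⟨⟨⟨hb, nil_mem_wordsOver _⟩, hs'⟩, hp', ha, nil_mem_wordsOver _⟩)
  have h2 := hcl ([a, b] ++ s' ++ p')
    (by simpa using hU.2 p' ([a, b] ++ s') (by simpa using hx))
    (by simp only [append_mem_wordsOver, cons_mem_wordsOver]
        exact ⟨⟨⟨ha, hb, nil_mem_wordsOver _⟩, hs'⟩, hp'⟩)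
  obtain ⟨m, hm⟩ := mem_kstar_singleton.1 h1
  obtain ⟨n, hn⟩ := mem_kstar_singleton.1 h2
  obtain rfl : m = n := by
    refine wordPow_injective_of_length (x := [a, b]) (y := [a, b]) (by simp) rfl ?_
    rw [← hm, ← hn]
    simp
    omega
  have := List.append_cancel_left (List.append_cancel_right (hm.trans hn.symm))
  simp only [List.cons_append, List.cons.injEq] at this
  exact hab this.1.symm

/-- The language `(ab)^* ∪ (ba)^*`. -/
def circularAlternating (a b : α) : Language α :=
  ({[a, b]} : Language α)∗ + ({[b, a]} : Language α)∗

theorem mem_circularAlternating {a b : α} {w : List α} : w ∈ circularAlternating a b ↔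
    ∃ n, w = wordPow [a, b] n ∨ w = wordPow [b, a] n := by
  rw [circularAlternating, Language.mem_add, mem_kstar_singleton, mem_kstar_singleton, exists_or]

theorem wordPow_pair_rotate (a b : α) (n : ℕ) :
    b :: wordPow [a, b] n ++ [a] = wordPow [b, a] (n + 1) := by
  induction n with
  | zero => rfl
  | succ n ih =>
    rw [wordPow_succ _ (n + 1), ← ih, wordPow_succ]
    rfl

theorem circ_circularAlternating [DecidableEq α] (a b : α) :
    CIRC {a, b} (circularAlternating a b) := by
  refine ⟨RegularOver.add (regularOver_singleton (pair_mem_wordsOver a b)).kstar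
    (regularOver_singleton ?_).kstar, fun x => ?_⟩
  · rw [Finset.pair_comm]
    exact pair_mem_wordsOver b a
  · induction x with
    | nil => intro y h; simpa using h
    | cons c x ih =>
      intro y h
      have h' : x ++ (y ++ [c]) ∈ circularAlternating a b := by
        rw [List.cons_append] at h
        obtain ⟨n, h | h⟩ := mem_circularAlternating.1 h
        · cases n with
          | zero => exact absurd h (List.cons_ne_nil _ _)
          | succ n =>
            rw [wordPow_succ] at h
            simp only [List.cons_append, List.nil_append, List.cons.injEq] at h
            obtain ⟨rfl, h⟩ := h
            rw [← List.append_assoc, h, wordPow_pair_rotate]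
            exact mem_circularAlternating.2 ⟨_, Or.inr rfl⟩
        · cases n with
          | zero => exact absurd h (List.cons_ne_nil _ _)
          | succ n =>
            rw [wordPow_succ] at h
            simp only [List.cons_append, List.nil_append, List.cons.injEq] at h
            obtain ⟨rfl, h⟩ := h
            rw [← List.append_assoc, h, wordPow_pair_rotate]
            exact mem_circularAlternating.2 ⟨_, Or.inl rfl⟩
      simpa using ih (y ++ [c]) h'

/-- Inside the selected word, a factor `a b a b` may be replaced by `a a b b`. -/
theorem not_covered_COMM_circularAlternating [DecidableEq α] {a b : α} (hab : a ≠ b) :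
    ¬ FinitelyCovered COMM {a, b} (circularAlternating a b) := by
  intro hcov
  obtain ⟨𝒮, N, -, h𝒮, hmid⟩ := hcov.exists_middle
  have heq : wordPow [a, b] (N + 1) ++ [a, b, a, b] ++ wordPow [a, b] (N + 1) =
      wordPow [a, b] (N + 1 + 2 + (N + 1)) := by
    rw [wordPow_add _ (N + 1 + 2), wordPow_add _ (N + 1) 2]
    rfl
  have hmem : wordPow [a, b] (N + 1) ++ [a, b, a, b] ++ wordPow [a, b] (N + 1) ∈
      circularAlternating a b := mem_circularAlternating.2 ⟨_, Or.inl heq⟩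
  obtain ⟨S, hS, u, p', s', v, hp, hs, -, -, hx, hcl⟩ :=
    hmid _ _ _ (by simp; omega) (by simp; omega) hmem
  obtain ⟨U, hU⟩ := h𝒮 S hS
  have hW := wordPow_mem_wordsOver (pair_mem_wordsOver a b) (N + 1)
  have hp' : p' ∈ wordsOver {a, b} := by
    rw [hp] at hW
    exact (append_mem_wordsOver.1 hW).2
  have hs' : s' ∈ wordsOver {a, b} := by
    rw [hs] at hW
    exact (append_mem_wordsOver.1 hW).1
  have ha : a ∈ ({a, b} : Finset α) := by simp
  have hb : b ∈ ({a, b} : Finset α) := by simp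
  have h1 := hcl (p' ++ [a, a, b, b] ++ s')
    (hU.2 _ hx _ (((((List.Perm.swap a b [b]).cons a)).append_left p').append_right s'))
    (by simp only [append_mem_wordsOver, cons_mem_wordsOver]
        exact ⟨⟨hp', ha, ha, hb, hb, nil_mem_wordsOver _⟩, hs'⟩)
  replace h1 : (u ++ p') ++ [a, a, b, b] ++ (s' ++ v) ∈ circularAlternating a b := by
    simpa using h1
  rw [← hp, ← hs] at h1
  obtain ⟨n, h | h⟩ := mem_circularAlternating.1 h1
  · obtain rfl : N + 1 + 2 + (N + 1) = n := by
      refine wordPow_injective_of_length (x := [a, b]) (y := [a, b]) (by simp) rfl ?_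
      rw [← h]
      simp
      omega
    rw [← heq] at h
    have := List.append_cancel_left (List.append_cancel_right h)
    simp only [List.cons.injEq] at this
    exact hab this.2.1
  · rcases n with _ | n
    · have := congrArg List.length h
      simp at this
    · rw [wordPow_succ, wordPow_succ] at h
      simp only [List.cons_append, List.cons.injEq] at h
      exact hab h.1

end

/-! ### A non-counting language that is not covered by ordered languages -/

/-- Starting in class `k`, a descending chain of `n + 1` states whose classes alternate between `k`
and `k + d`. -/
def AlternatingChain {Z : Type*} [LT Z] (R : Z → ZMod 3 → Prop) :
    ℕ → Z → ZMod 3 → ZMod 3 → Prop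
  | 0, s, k, _ => R s k
  | n + 1, s, k, d => R s k ∧ ∃ t < s, AlternatingChain R n t (k + d) (-d)

theorem AlternatingChain.left {Z : Type*} [LT Z] {R : Z → ZMod 3 → Prop} {n : ℕ} {s : Z}
    {k d : ZMod 3} (h : AlternatingChain R n s k d) : R s k := by
  cases n with
  | zero => exact h
  | succ n => exact h.1

theorem AlternatingChain.le_card {Z : Type*} [Fintype Z] [LinearOrder Z] {R : Z → ZMod 3 → Prop}
    {n : ℕ} {s : Z} {k d : ZMod 3} (h : AlternatingChain R n s k d) :
    n ≤ (Finset.univ.filter (· < s)).card := by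
  induction n generalizing s k d with
  | zero => exact Nat.zero_le _
  | succ n ih =>
    obtain ⟨-, t, hts, ht⟩ := h
    refine (ih ht).trans_lt (Finset.card_lt_card ?_)
    refine (Finset.ssubset_iff_of_subset fun x hx => ?_).2 ⟨t, by simpa using hts, by simp⟩
    simp only [Finset.mem_filter, Finset.mem_univ, true_and] at hx ⊢
    exact hx.trans hts

/-- Let the states of a finite chain be partially assigned to the classes `0`, `1`, `2`, and let
three monotone maps advance the class by one, the `j`-th being required to do so on the classes
other than `j` only. This is impossible: an alternating chain of maximal length is moved to chains
of maximal length in the other pairs of classes, and their greatest elements would have to be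
ordered cyclically. -/
theorem not_exists_monotone_rotation {Z : Type*} [Fintype Z] [LinearOrder Z]
    (f : ZMod 3 → Z → Z) (hf : ∀ j, Monotone (f j)) (R : Z → ZMod 3 → Prop)
    (huniq : ∀ s k k', R s k → R s k' → k = k')
    (hstep : ∀ s k j, R s k → j ≠ k → R (f j s) (k + 1)) (hex : ∃ s, R s 0) : False := by
  have hclass : ∀ k d : ZMod 3, k + d - -d = k - d := by decide
  have hmove : ∀ n s k d, d ≠ 0 → AlternatingChain R n s k d →
      AlternatingChain R n (f (k - d) s) (k + 1) d := by
    intro n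
    induction n with
    | zero => exact fun s k d hd h => hstep s k _ h (by simpa using hd)
    | succ n ih =>
      rintro s k d hd ⟨hs, t, hts, ht⟩
      have h1 := hstep s k (k - d) hs (by simpa using hd)
      have h2 := ih t (k + d) (-d) (neg_ne_zero.2 hd) ht
      rw [hclass k d, show k + d + 1 = k + 1 + d by ring] at h2
      refine ⟨h1, _, lt_of_le_of_ne (hf _ hts.le) fun heq => hd ?_, h2⟩
      have := huniq _ _ _ (heq ▸ h2.left) h1
      simpa using this
  -- a chain of maximal length
  have hbdd : ∃ n, (∃ s k d, d ≠ 0 ∧ AlternatingChain R n s k d) ∧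
      ¬ ∃ s k d, d ≠ 0 ∧ AlternatingChain R (n + 1) s k d := by
    by_contra! h
    have hall : ∀ n, ∃ s k d, d ≠ 0 ∧ AlternatingChain R n s k d := by
      intro n
      induction n with
      | zero =>
        obtain ⟨s, hs⟩ := hex
        exact ⟨s, 0, 1, by decide, hs⟩
      | succ n ih => exact h n ih
    obtain ⟨s, k, d, -, hc⟩ := hall (Fintype.card Z + 1)
    have := hc.le_card.trans (Finset.card_le_univ _)
    omega
  obtain ⟨n, ⟨s, k, d, hd, hc⟩, hmax⟩ := hbdd
  -- the greatest element of such a chain exceeds all states of the other class of the chain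
  have htop : ∀ s k, AlternatingChain R n s k d → ∀ t, R t (k + d) → t < s := by
    intro s k hc t ht
    refine lt_of_not_ge fun hle => ?_
    rcases hle.lt_or_eq with hlt | rfl
    · refine hmax ⟨t, k + d, -d, neg_ne_zero.2 hd, ht, s, hlt, ?_⟩
      simpa using hc
    · have := huniq _ _ _ hc.left ht
      exact hd (by simpa using this)
  have hc1 := hmove n s k d hd hc
  have hc2 := hmove n _ _ d hd hc1
  set s1 := f (k - d) s
  set s2 := f (k + 1 - d) s1
  have h0 := hc.left
  have h1 := hc1.left
  have h2 := hc2.left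
  have hd' : d = 1 ∨ d = -1 := (by decide : ∀ d : ZMod 3, d ≠ 0 → d = 1 ∨ d = -1) d hd
  rcases hd' with rfl | rfl
  · have e1 := htop s k hc s1 h1
    have e2 := htop s1 (k + 1) hc1 s2 h2
    have e3 := htop s2 (k + 1 + 1) hc2 s (by
      rwa [(by decide : ∀ k : ZMod 3, k + 1 + 1 + 1 = k) k])
    exact lt_irrefl _ (e3.trans (e2.trans e1))
  · have e1 := htop s k hc s2 (by
      rwa [(by decide : ∀ k : ZMod 3, k + -1 = k + 1 + 1) k])
    have e2 := htop s1 (k + 1) hc1 s (by simpa using h0)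
    have e3 := htop s2 (k + 1 + 1) hc2 s1 (by simpa using h1)
    exact lt_irrefl _ (e2.trans (e3.trans e1))

/-- The partial automaton on the residues modulo three in which each of the letters `a 0`, `a 1`,
`a 2` advances the state by one, except that the letter `a k` is not defined in state `k`; the state
`none` is the sink. A word is accepted if it leads from `0` to `0`. -/
def rotationDFA [DecidableEq α] (a : ZMod 3 → α) : DFA α (Option (ZMod 3)) where
  step q c := q.bind fun k => if (∃ j, c = a j) ∧ c ≠ a k then some (k + 1) else none
  start := some 0
  accept := {some 0}

section rotation

variable [DecidableEq α] (a : ZMod 3 → α)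

theorem rotationDFA_evalFrom_none (w : List α) : (rotationDFA a).evalFrom none w = none := by
  induction w with
  | nil => rfl
  | cons c w ih => rw [DFA.evalFrom_cons]; exact ih

theorem rotationDFA_step_some_iff {k l : ZMod 3} {c : α} :
    (rotationDFA a).step (some k) c = some l ↔ (∃ j, c = a j) ∧ c ≠ a k ∧ l = k + 1 := by
  change (if (∃ j, c = a j) ∧ c ≠ a k then some (k + 1) else none) = some l ↔ _
  split_ifs with h
  · simp [h.1, h.2, eq_comm]
  · simp only [false_iff]
    tauto

theorem rotationDFA_step_self (k : ZMod 3) : (rotationDFA a).step (some k) (a k) = none :=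
  if_neg fun h => h.2 rfl

theorem rotationDFA_evalFrom_eq_some {k l : ZMod 3} {w : List α}
    (h : (rotationDFA a).evalFrom (some k) w = some l) :
    l = k + w.length ∧ w ∈ wordsOver (Finset.univ.image a) := by
  induction w generalizing k with
  | nil => simpa [eq_comm] using h
  | cons c w ih =>
    rw [DFA.evalFrom_cons] at h
    obtain ⟨k', hk'⟩ : ∃ k', (rotationDFA a).step (some k) c = some k' := by
      rw [← Option.ne_none_iff_exists']
      intro hn
      rw [hn, rotationDFA_evalFrom_none] at h
      exact Option.some_ne_none _ h.symm
    obtain ⟨⟨j, rfl⟩, -, rfl⟩ := (rotationDFA_step_some_iff a).1 hk'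
    rw [hk'] at h
    obtain ⟨rfl, hw⟩ := ih h
    refine ⟨by push_cast [List.length_cons]; ring, cons_mem_wordsOver.2 ⟨by simp, hw⟩⟩

/-- The language of `rotationDFA`: the words over `a 0`, `a 1`, `a 2` of length divisible by three
that do not have the letter `a (j mod 3)` in position `j`. -/
def rotationWords : Language α := (rotationDFA a).accepts

theorem mem_rotationWords {w : List α} :
    w ∈ rotationWords a ↔ (rotationDFA a).evalFrom (some 0) w = some 0 := Iff.rfl

theorem rotationWords_le : rotationWords a ≤ wordsOver (Finset.univ.image a) := fun _ hw =>
  (rotationDFA_evalFrom_eq_some a ((mem_rotationWords a).1 hw)).2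

theorem append_mem_rotationWords {v w : List α} (hv : v ∈ rotationWords a) :
    v ++ w ∈ rotationWords a ↔ w ∈ rotationWords a := by
  rw [mem_rotationWords] at hv
  rw [mem_rotationWords, mem_rotationWords, DFA.evalFrom_of_append, hv]

/-- A word whose length is divisible by three fixes every state that it does not send to the sink.
Reading any other word three times leads to the sink, as its first letter is then read in all three
states. -/
theorem nc_rotationWords : NC (Finset.univ.image a) (rotationWords a) := by
  refine ⟨⟨⟨_, inferInstance, _, rfl⟩, rotationWords_le a⟩, 3, by norm_num,
    fun x _ y _ z _ => ?_⟩
  simp only [mem_rotationWords, DFA.evalFrom_of_append, DFA_evalFrom_wordPow]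
  suffices h : ∀ q, (fun t => (rotationDFA a).evalFrom t y)^[3] q =
      (fun t => (rotationDFA a).evalFrom t y)^[3 + 1] q by rw [h]
  intro q
  rw [Function.iterate_succ_apply' _ 3 q]
  by_cases hq : (fun t => (rotationDFA a).evalFrom t y)^[3] q = none
  · rw [hq, rotationDFA_evalFrom_none]
  have hnone : ∀ q, (rotationDFA a).evalFrom q y ≠ none → q ≠ none := by
    rintro _ h rfl
    exact h (rotationDFA_evalFrom_none a y)
  simp only [Function.iterate_succ_apply', Function.iterate_zero_apply] at hq ⊢
  have hq2 := hnone _ hq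
  have hq1 := hnone _ hq2
  obtain ⟨k0, rfl⟩ := Option.ne_none_iff_exists'.1 (hnone _ hq1)
  obtain ⟨k1, h1⟩ := Option.ne_none_iff_exists'.1 hq1
  rw [h1] at hq2 hq ⊢
  obtain ⟨k2, h2⟩ := Option.ne_none_iff_exists'.1 hq2
  rw [h2] at hq ⊢
  obtain ⟨k3, h3⟩ := Option.ne_none_iff_exists'.1 hq
  rw [h3]
  have e1 := (rotationDFA_evalFrom_eq_some a h1).1
  have e2 := (rotationDFA_evalFrom_eq_some a h2).1
  have e3 := (rotationDFA_evalFrom_eq_some a h3).1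
  by_cases hl : (y.length : ZMod 3) = 0
  · rw [hl, add_zero] at e1 e2 e3
    subst e1 e2 e3
    exact h3.symm
  exfalso
  rcases y with _ | ⟨c, y⟩
  · simp at hl
  have hc : ∀ {k l}, (rotationDFA a).evalFrom (some k) (c :: y) = some l →
      (∃ j, c = a j) ∧ c ≠ a k := by
    intro k l h
    rw [DFA.evalFrom_cons] at h
    obtain ⟨k', hk'⟩ : ∃ k', (rotationDFA a).step (some k) c = some k' := by
      rw [← Option.ne_none_iff_exists']
      intro hn
      rw [hn, rotationDFA_evalFrom_none] at h
      exact Option.some_ne_none _ h.symm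
    have := (rotationDFA_step_some_iff a).1 hk'
    exact ⟨this.1, this.2.1⟩
  obtain ⟨⟨j, rfl⟩, c0⟩ := hc h1
  have c1 := (hc h2).2
  have c2 := (hc h3).2
  have n0 : j ≠ k0 := fun h => c0 (congrArg a h)
  have n1 : j ≠ k1 := fun h => c1 (congrArg a h)
  have n2 : j ≠ k2 := fun h => c2 (congrArg a h)
  rw [e1] at n1
  rw [e2, e1] at n2
  generalize ((a j :: y).length : ZMod 3) = l at *
  clear * - n0 n1 n2 hl
  revert j k0 l
  decide

variable {a}

theorem exists_rotationDFA_evalFrom (ha : Function.Injective a) (k l : ZMod 3) (n : ℕ) :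
    ∃ w, n ≤ w.length ∧ (rotationDFA a).evalFrom (some k) w = some l := by
  have key : ∀ (n : ℕ) (k : ZMod 3), ∃ w : List α, w.length = n ∧
      (rotationDFA a).evalFrom (some k) w = some (k + n) := by
    intro n
    induction n with
    | zero => exact fun k => ⟨[], rfl, by simp⟩
    | succ n ih =>
      intro k
      obtain ⟨w, hw, h⟩ := ih (k + 1)
      refine ⟨a (k + 1) :: w, by simp [hw], ?_⟩
      rw [DFA.evalFrom_cons, (rotationDFA_step_some_iff a).2
        ⟨⟨_, rfl⟩, fun h => absurd (ha h) (by simp), rfl⟩, h]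
      push_cast
      congr 1
      ring
  obtain ⟨w, hw, h⟩ := key (3 * n + (l - k).val) k
  refine ⟨w, by omega, ?_⟩
  rw [h]
  have h3 : (3 : ZMod 3) = 0 := rfl
  push_cast
  rw [h3, ZMod.natCast_val, ZMod.cast_id]
  congr 1
  ring

/-- Choose a word of the language after which as few pieces of the covering as possible can still be
completed. The automaton of a remaining piece then has to follow every continuation within the
language, hence to distinguish the three residues, against `not_exists_monotone_rotation`. -/
theorem not_covered_ORD_rotationWords (ha : Function.Injective a) :
    ¬ FinitelyCovered ORD (Finset.univ.image a) (rotationWords a) := by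
  classical
  rintro ⟨𝒟, N, hfin, h𝒟, hcov⟩
  -- the pieces that contain a word of the language with the prefix `w`
  let alive : List α → Set (Language α × List α × List α) := fun w =>
    {d | d ∈ 𝒟 ∧ ∃ z, w ++ z ∈ rotationWords a ∧ ∃ x ∈ d.1, w ++ z = d.2.1 ++ x ++ d.2.2}
  have halive_sub : ∀ w v, alive (w ++ v) ⊆ alive w := by
    rintro w v d ⟨hd, z, hz, x, hx, h⟩
    exact ⟨hd, v ++ z, by simpa using hz, x, hx, by simpa using h⟩
  have halive_fin : ∀ w, (alive w).Finite := fun w => hfin.subset fun d hd => hd.1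
  have hexn : ∃ n, ∃ w ∈ rotationWords a, N ≤ w.length ∧ (alive w).ncard = n := by
    obtain ⟨w, hw, h⟩ := exists_rotationDFA_evalFrom ha 0 0 N
    exact ⟨_, w, h, hw, rfl⟩
  obtain ⟨w, hw, hwN, hwn⟩ := Nat.find_spec hexn
  have hmin : ∀ v ∈ rotationWords a, alive (w ++ v) = alive w := by
    intro v hv
    refine Set.eq_of_subset_of_ncard_le (halive_sub w v) ?_ (halive_fin w)
    rw [hwn]
    exact Nat.find_min' hexn ⟨w ++ v, (append_mem_rotationWords a hw).2 hv, by simp; omega, rfl⟩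
  obtain ⟨⟨S, u, v⟩, hd, x, hx, hwx⟩ := hcov w hw hwN
  have halive : ∀ y ∈ rotationWords a, ∃ z, w ++ y ++ z ∈ rotationWords a ∧
      ∃ x ∈ S, w ++ y ++ z = u ++ x ++ v := by
    intro y hy
    have : (S, u, v) ∈ alive (w ++ y) := by
      rw [hmin y hy]
      exact ⟨hd, [], by simpa using hw, x, hx, by simpa using hwx⟩
    exact this.2
  obtain ⟨⟨U, hU⟩, hu, hv, hcl⟩ := h𝒟 _ hd
  simp only at hU hu hv hcl hx hwx
  obtain ⟨r, rfl⟩ : ∃ r, w = u ++ r := by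
    have h1 : u <+: w := ⟨x ++ v, by simpa using hwx.symm⟩
    obtain ⟨r, hr⟩ := h1
    exact ⟨r, hr.symm⟩
  obtain ⟨Z, _, _, M, hM, rfl⟩ := hU.exists_monotone_DFA
  have hw0 : (rotationDFA a).evalFrom (some 0) (u ++ r) = some 0 := hw
  have hrA : r ∈ wordsOver (Finset.univ.image a) :=
    (append_mem_wordsOver.1 (rotationWords_le a hw)).2
  refine not_exists_monotone_rotation (fun j z => M.step z (a j)) (fun j => hM (a j))
    (fun s k => ∃ y, (rotationDFA a).evalFrom (some 0) y = some k ∧ M.eval (r ++ y) = s)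
    ?_ ?_ ⟨_, [], rfl, rfl⟩
  · rintro s k k' ⟨y, hy, hys⟩ ⟨y', hy', hys'⟩
    by_contra hne
    -- the letter `a k` continues `y'`, but not `y`
    have hstep : (rotationDFA a).evalFrom (some 0) (y' ++ [a k]) = some (k' + 1) := by
      rw [DFA.evalFrom_of_append, hy', DFA.evalFrom_singleton]
      exact (rotationDFA_step_some_iff a).2 ⟨⟨k, rfl⟩, fun h => hne (ha h), rfl⟩
    obtain ⟨g, hgN, hg⟩ := exists_rotationDFA_evalFrom ha (k' + 1) 0 N
    obtain ⟨z, hz, x', hx', heq⟩ := halive (y' ++ [a k] ++ g) (by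
      rw [mem_rotationWords, DFA.evalFrom_of_append, hstep, hg])
    have heq' : (r ++ y' ++ [a k]) ++ (g ++ z) = x' ++ v := by
      simp only [List.append_assoc] at heq
      simpa using List.append_cancel_left heq
    obtain ⟨t, rfl, ht⟩ : ∃ t, x' = r ++ y' ++ [a k] ++ t ∧ g ++ z = t ++ v := by
      rcases List.append_eq_append_iff.1 heq' with ⟨t, h1, h2⟩ | ⟨t, h1, h2⟩
      · exact ⟨t, h1, h2⟩
      · have hl := congrArg List.length h2
        simp only [List.length_append] at hl
        obtain rfl : t = [] := List.length_eq_zero_iff.1 (by omega)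
        exact ⟨[], by simpa using h1.symm, by simpa using h2.symm⟩
    have hmem : r ++ y ++ [a k] ++ t ∈ M.accepts := by
      rw [DFA.mem_accepts, DFA.eval, List.append_assoc, DFA.evalFrom_of_append] at hx' ⊢
      have e : M.evalFrom M.start (r ++ y) = M.evalFrom M.start (r ++ y') := hys.trans hys'.symm
      rw [e]
      exact hx'
    have htA : t ∈ wordsOver (Finset.univ.image a) := by
      have h1 := rotationWords_le a hz
      rw [heq] at h1
      exact (append_mem_wordsOver.1 (append_mem_wordsOver.1 (append_mem_wordsOver.1 h1).1).2).2
    have h1 := hcl _ hmem (append_mem_wordsOver.2 ⟨append_mem_wordsOver.2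
      ⟨append_mem_wordsOver.2 ⟨hrA, (rotationDFA_evalFrom_eq_some a hy).2⟩,
        cons_mem_wordsOver.2 ⟨by simp, nil_mem_wordsOver _⟩⟩, htA⟩)
    rw [show u ++ (r ++ y ++ [a k] ++ t) ++ v = (u ++ r) ++ (y ++ ([a k] ++ (t ++ v))) by simp,
      append_mem_rotationWords a hw, mem_rotationWords, DFA.evalFrom_of_append, hy,
      DFA.evalFrom_of_append, DFA.evalFrom_singleton, rotationDFA_step_self,
      rotationDFA_evalFrom_none] at h1
    exact Option.some_ne_none _ h1.symm
  · rintro s k j ⟨y, hy, rfl⟩ hjk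
    refine ⟨y ++ [a j], ?_, ?_⟩
    · rw [DFA.evalFrom_of_append, hy, DFA.evalFrom_singleton]
      exact (rotationDFA_step_some_iff a).2 ⟨⟨j, rfl⟩, fun h => hjk (ha h), rfl⟩
    · rw [← List.append_assoc, DFA.eval_append_singleton]

end rotation

/-! ### The hierarchy -/

theorem EC_subset_of_arrow {X Y : Node} (h : Arrow X Y) :
    EC (X.family α) ⊆ EC (Y.family α) := by
  simp only [Arrow, arrows, List.mem_cons, Prod.mk.injEq, List.not_mem_nil, or_false] at h
  rcases h with h | h | h | h | h | h | h | h | h | h | h | h | h | h | h | h | h | h | h | h | h <;>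
    obtain ⟨rfl, rfl⟩ := h
  exacts [EC_FIN_subset_MON, EC_mono fun _ _ => MON.nil, EC_MON_subset_COMB,
    EC_mono fun _ _ => MON.inf, EC_mono fun _ _ => MON.star, EC_mono fun _ _ => COMB.defn,
    EC_NIL_subset defn_longWords, EC_NIL_subset comm_longWords, EC_DEF_subset_ORD,
    EC_DEF_subset_SYDEF, EC_mono fun _ _ => ORD.nc, EC_mono fun _ _ => NC.ps,
    EC_mono fun _ _ => SYDEF.ps, EC_mono fun _ _ => INF.suf, EC_mono fun _ _ => INF.pre,
    EC_mono fun _ _ => SUF.ps, EC_mono fun _ _ => PRE.ps, EC_mono fun _ _ => COMM.circ,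
    EC_mono fun _ _ h => h.1, EC_mono fun _ _ h => h.1, EC_mono fun _ _ h => h.1]

theorem EC_subset_of_hasPath {X Y : Node} (h : HasPath X Y) :
    EC (X.family α) ⊆ EC (Y.family α) := by
  induction h with
  | refl => exact subset_rfl
  | tail _ h ih => exact ih.trans (EC_subset_of_arrow h)

/-- Pairs of nodes `(X, Y)` for which `EC X` is not contained in `EC Y`, with `X` minimal and `Y`
maximal; by monotonicity they account for all pairs without a path from `X` to `Y`. -/
def separations : List (Node × Node) :=
  [(.mon, .fin),
   (.comb, .suf), (.comb, .pre), (.comb, .star), (.comb, .circ),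
   (.nil, .suf), (.nil, .pre), (.nil, .star), (.nil, .comb),
   (.inf, .nc), (.inf, .sydef), (.inf, .circ), (.inf, .star),
   (.star, .ps), (.star, .circ), (.comm, .ps),
   (.ord, .sydef), (.sydef, .nc), (.suf, .pre), (.pre, .suf),
   (.nc, .ord), (.circ, .comm)]

theorem not_EC_subset_of_mem_separations [Infinite α] {X Y : Node} (h : (X, Y) ∈ separations) :
    ¬ EC (X.family α) ⊆ EC (Y.family α) := by
  classical
  have hmon : ∀ A : Finset α, MON A (wordsOver A) := fun A => ⟨regularOver_wordsOver A, rfl⟩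
  obtain ⟨a, b, c, hab, hac, hbc⟩ := exists_ne_letters α
  have hinf := inf_sortedWords hab
  have hodd := inf_noOddBlock a b
  let f : ZMod 3 → α := fun k => Infinite.natEmbedding α k.val
  have hf : Function.Injective f :=
    (Infinite.natEmbedding α).injective.comp (ZMod.val_injective 3)
  have hsuf := not_EC_subset_of_nil_mem (α := α) SUF.nil_mem
  have hpre := not_EC_subset_of_nil_mem (α := α) PRE.nil_mem
  have hstar := not_EC_subset_of_nil_mem (α := α) STAR.nil_mem
  simp only [separations, List.mem_cons, Prod.mk.injEq, List.not_mem_nil, or_false] at h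
  rcases h with h | h | h | h | h | h | h | h | h | h | h | h | h | h | h | h | h | h | h | h | h |
    h <;> obtain ⟨rfl, rfl⟩ := h
  · exact not_EC_MON_subset_FIN
  · exact hsuf.1
  · exact hpre.1
  · exact hstar.1
  · exact not_EC_COMB_subset_CIRC
  · exact hsuf.2
  · exact hpre.2
  · exact hstar.2
  · exact not_EC_NIL_subset_COMB
  · exact not_EC_subset_of_not_finitelyCovered (by simp) hodd.1.2 (hmon _).inf hodd
      (not_covered_NC_noOddBlock hab)
  · exact not_EC_subset_of_not_finitelyCovered (by simp) hinf.1.2 (hmon _).inf hinf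
      (not_covered_SYDEF_sortedWords hab)
  · exact not_EC_subset_of_not_finitelyCovered (by simp) hinf.1.2 (hmon _).inf hinf
      (not_covered_CIRC_sortedWords hab)
  · exact not_EC_subset_of_not_finitelyCovered (by simp) hinf.1.2 (hmon _).inf hinf
      (not_covered_STAR_sortedWords hab)
  · exact not_EC_subset_of_not_finitelyCovered (by simp) (star_evenPowers a).1.2 (hmon _).star
      (star_evenPowers a) (not_covered_PS_evenPowers a)
  · exact not_EC_subset_of_not_finitelyCovered (by simp) (star_alternating a b).1.2 (hmon _).star
      (star_alternating a b) (not_covered_CIRC_alternating hab)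
  · exact not_EC_subset_of_not_finitelyCovered (by simp) (comm_evenPowers a).1.2 (hmon _).comm
      (comm_evenPowers a) (not_covered_PS_evenPowers a)
  · exact not_EC_subset_of_not_finitelyCovered (by simp) hinf.1.2 (hmon _).ord
      (ord_sortedWords hab) (not_covered_SYDEF_sortedWords hab)
  · exact not_EC_subset_of_not_finitelyCovered (by simp) (sydef_evenPrefix a b).1.2 (hmon _).sydef
      (sydef_evenPrefix a b) (not_covered_NC_evenPrefix hab)
  · exact not_EC_subset_of_not_finitelyCovered (by simp) (suf_sandwichOrRight a b c).1.2
      (hmon _).inf.suf (suf_sandwichOrRight a b c) (not_covered_PRE_sandwichOrRight hab hac hbc)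
  · exact not_EC_subset_of_not_finitelyCovered (by simp) (pre_sandwichOrLeft a b c).1.2
      (hmon _).inf.pre (pre_sandwichOrLeft a b c) (not_covered_SUF_sandwichOrLeft hab hac hbc)
  · exact not_EC_subset_of_not_finitelyCovered (by simp) (nc_rotationWords f).1.2 (hmon _).nc
      (nc_rotationWords f) (not_covered_ORD_rotationWords hf)
  · exact not_EC_subset_of_not_finitelyCovered (by simp) (circ_circularAlternating a b).1.2
      (hmon _).comm.circ (circ_circularAlternating a b) (not_covered_COMM_circularAlternating hab)

/-- The end nodes of the directed paths of length at most `n` from a node. -/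
def reachable : ℕ → Node → List Node
  | 0, X => [X]
  | n + 1, X => X :: (arrows.filter fun e => e.1 = X).flatMap fun e => reachable n e.2

theorem hasPath_of_mem_reachable {n : ℕ} {X Y : Node} (h : Y ∈ reachable n X) : HasPath X Y := by
  induction n generalizing X with
  | zero =>
    obtain rfl : Y = X := by simpa [reachable] using h
    exact .refl
  | succ n ih =>
    simp only [reachable, List.mem_cons, List.mem_flatMap, List.mem_filter,
      decide_eq_true_eq] at h
    rcases h with rfl | ⟨⟨X', Z⟩, ⟨he, rfl⟩, hY⟩
    · exact .refl
    · exact (ih hY).head he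

theorem not_EC_subset_of_separation [Infinite α] {n : ℕ} {X Y : Node}
    (h : ∃ p ∈ separations, X ∈ reachable n p.1 ∧ p.2 ∈ reachable n Y) :
    ¬ EC (X.family α) ⊆ EC (Y.family α) := by
  obtain ⟨⟨X', Y'⟩, hp, hX, hY⟩ := h
  exact fun hsub => not_EC_subset_of_mem_separations hp
    ((EC_subset_of_hasPath (hasPath_of_mem_reachable hX)).trans
      (hsub.trans (EC_subset_of_hasPath (hasPath_of_mem_reachable hY))))

/-- The longest path in the diagram, from `fin` by way of `ord` to `reg`, has length seven, so that
`reachable 7` lists all nodes that can be reached. -/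
theorem not_EC_subset_of_not_hasPath [Infinite α] {X Y : Node} (h : ¬ HasPath X Y) :
    ¬ EC (X.family α) ⊆ EC (Y.family α) := by
  have key : Y ∈ reachable 7 X ∨
      ∃ p ∈ separations, X ∈ reachable 7 p.1 ∧ p.2 ∈ reachable 7 Y := by
    clear h
    cases X <;> cases Y <;> decide
  exact not_EC_subset_of_separation (key.resolve_left fun hr => h (hasPath_of_mem_reachable hr))

theorem EC_ssubset_of_arrow [Infinite α] {X Y : Node} (h : Arrow X Y) :
    EC (X.family α) ⊂ EC (Y.family α) := by
  have key : ∀ e ∈ arrows, ∃ p ∈ separations, e.2 ∈ reachable 7 p.1 ∧ p.2 ∈ reachable 7 e.1 := by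
    decide
  exact ⟨EC_subset_of_arrow h, not_EC_subset_of_separation (key _ h)⟩

end ContextualGrammars

theorem mainTheorem3 {α : Type*} [Infinite α] :
    (∀ X Y : ContextualGrammars.Node, ContextualGrammars.Arrow X Y →
      ContextualGrammars.EC (X.family α) ⊂ ContextualGrammars.EC (Y.family α)) ∧
    (∀ X Y : ContextualGrammars.Node,
      ¬ ContextualGrammars.HasPath X Y → ¬ ContextualGrammars.HasPath Y X →
        ContextualGrammars.Incomparable
          (ContextualGrammars.EC (X.family α)) (ContextualGrammars.EC (Y.family α))) ∧
    (ContextualGrammars.EC (ContextualGrammars.REG (α := α)) =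
        ContextualGrammars.EC (ContextualGrammars.UF (α := α)) ∧
      ContextualGrammars.EC (ContextualGrammars.UF (α := α)) =
        ContextualGrammars.EC (ContextualGrammars.LCOM (α := α)) ∧
      ContextualGrammars.EC (ContextualGrammars.LCOM (α := α)) =
        ContextualGrammars.EC (ContextualGrammars.RCOM (α := α)) ∧
      ContextualGrammars.EC (ContextualGrammars.RCOM (α := α)) =
        ContextualGrammars.EC (ContextualGrammars.TCOM (α := α))) := by
  have h1 : ContextualGrammars.EC (ContextualGrammars.REG (α := α)) =
      ContextualGrammars.EC ContextualGrammars.UF :=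
    ContextualGrammars.EC_REG_subset_UF.antisymm (ContextualGrammars.EC_mono fun _ _ h => h.1)
  have h2 : ContextualGrammars.EC (ContextualGrammars.REG (α := α)) =
      ContextualGrammars.EC ContextualGrammars.LCOM :=
    ContextualGrammars.EC_REG_subset_LCOM.antisymm (ContextualGrammars.EC_mono fun _ _ h => h.1)
  have h3 : ContextualGrammars.EC (ContextualGrammars.REG (α := α)) =
      ContextualGrammars.EC ContextualGrammars.RCOM :=
    ContextualGrammars.EC_REG_subset_RCOM.antisymm (ContextualGrammars.EC_mono fun _ _ h => h.1)
  have h4 : ContextualGrammars.EC (ContextualGrammars.REG (α := α)) =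
      ContextualGrammars.EC ContextualGrammars.TCOM :=
    ContextualGrammars.EC_REG_subset_TCOM.antisymm (ContextualGrammars.EC_mono fun _ _ h => h.1)
  exact ⟨fun _ _ => ContextualGrammars.EC_ssubset_of_arrow,
    fun _ _ hXY hYX => ⟨ContextualGrammars.not_EC_subset_of_not_hasPath hXY,
      ContextualGrammars.not_EC_subset_of_not_hasPath hYX⟩,
    h1, h1.symm.trans h2, h2.symm.trans h3, h3.symm.trans h4⟩
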